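/- Let $k$ be a field, $G$ a finite group, $X$ a set of representatives of the conjugacy classes of $G$. For $x\in X$ let $C_G(x)$ be the centralizer of $x$, choose representatives $\gamma_{1,x}=1,\gamma_{2,x},\dots,\gamma_{n_x,x}$ of the right cosets of $C_G(x)$ in $G$, so that $G=\bigsqcup_i C_G(x)\gamma_{i,x}$, and put $x_i=\gamma_{i,x}^{-1}x\gamma_{i,x}$. For $i\in\{1,\dots,n_x\}$ and $g_1,\dots,g_n\in G$ let $h_{i,1},\dots,h_{i,n}\in C_G(x)$ (and indices $s_i^1,\dots,s_i^n$) be determined by $$\gamma_{i,x}g_1=h_{i,1}\gamma_{s_i^1,x},\quad \gamma_{s_i^1,x}g_2=h_{i,2}\gamma_{s_i^2,x},\ \dots,\ \gamma_{s_i^{n-1},x}g_n=h_{i,n}\gamma_{s_i^n,x}.$$ Compute $HH^*(kG)=\bigoplus_n HH^n(kG)$ by the normalized Hochschild complex (multilinear maps $\varphi:(kG)^n\to kG$ that vanish when an argument is $1$), with the cup product induced by $(\varphi\cup\psi)(a_1,\dots,a_{n+m})=\varphi(a_1,\dots,a_n)\,\psi(a_{n+1},\dots,a_{n+m})$. Compute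 $H^*(C_G(x),k)$, with trivial coefficients, by the normalized bar complex (maps $f:C_G(x)^n\to k$ that vanish when an argument is $1$). For normalized cocycles $\widehat\varphi_x:C_G(x)^n\to k$ and $\widehat\varphi_y:C_G(y)^m\to k$ $(x,y\in X)$ and for $z\in X$ define $(\widehat\varphi_x\cup\widehat\varphi_y)_z:C_G(z)^{n+m}\to k$ by $$(\widehat\varphi_x\cup\widehat\varphi_y)_z(h_1,\dots,h_{n+m})=\sum_{(i,j)}\widehat\varphi_x(h_{i,1},\dots,h_{i,n})\,\widehat\varphi_y(h_{j,1},\dots,h_{j,m}),$$ where the sum is over the pairs $(i,j)$, $1\le i\le n_x$, $1\le j\le n_y$, with $x_i\,h_1\cdots h_n\,y_j\,(h_1\cdots h_n)^{-1}=z$, where $h_{i,1},\dots,h_{i,n}\in C_G(x)$ are determined as above by $\gamma_{i,x}$ and $(h_1,\dots,h_n)$, and $h_{j,1},\dots,h_{j,m}\in C_G(y)$ by $\gamma_{j,y}$ and $(h_{n+1},\dots,h_{n+m})$. Then each $(\widehat\varphi_x\cup\widehat\varphi_y)_z$ is a normalized cocycle, and $$[\widehat\varphi_x]\cdot[\widehat\varphi_y]=\sum_{z\in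 X}\bigl[(\widehat\varphi_x\cup\widehat\varphi_y)_z\bigr]$$ is a well-defined product that makes $\bigoplus_{x\in X}H^*(C_G(x),k)$ a graded (associative, unital) $k$-algebra. The map $$HH^*(kG)\longrightarrow\bigoplus_{x\in X}H^*(C_G(x),k),\qquad [\varphi]\longmapsto\sum_{x\in X}[\widehat\varphi_x],$$ where $\widehat\varphi_x(h_1,\dots,h_n)$ is the coefficient of $x$ in $\varphi(h_1,\dots,h_n)\,h_n^{-1}\cdots h_1^{-1}$, is well defined and is an isomorphism of graded $k$-algebras from $HH^*(kG)$ with the cup product to $\bigoplus_{x\in X}H^*(C_G(x),k)$ with this product. Its inverse sends the class of a normalized cocycle $\widehat\varphi_x:C_G(x)^n\to k$ to the class of the cocycle $\varphi_x$ with $$\varphi_x(g_1,\dots,g_n)=\sum_{i=1}^{n_x}\widehat\varphi_x(h_{i,1},\dots,h_{i,n})\,x_i\,g_1\cdots g_n\qquad(g_1,\dots,g_n\in G).$$ -/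

import Mathlib

open scoped DirectSum

noncomputable section

/-! ### Hochschild cohomology of an algebra, through the normalized bar resolution -/

namespace Hochschild

universe u v

variable (k : Type u) [CommRing k] (A : Type v) [Ring A] [Algebra k A]

/-- Normalized Hochschild cochains of degree `n` of the `k`-algebra `A` with values in `A`:
the `k`-multilinear maps `Aⁿ → A` which vanish as soon as one argument is `1`, that is, the
`k`-linear maps `(A / k·1)^{⊗ n} → A`. -/
def cochain (n : ℕ) : Submodule k ((Fin n → A) → A) where
  carrier := {f | (∃ F : MultilinearMap k (fun _ : Fin n => A) A, ∀ a, F a = f a) ∧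
    ∀ a : Fin n → A, (∃ i, a i = 1) → f a = 0}
  add_mem' := by
    rintro f g ⟨⟨F, hF⟩, hf⟩ ⟨⟨F', hF'⟩, hg⟩
    exact ⟨⟨F + F', fun a => by simp [hF, hF']⟩, fun a h => by simp [hf a h, hg a h]⟩
  zero_mem' := ⟨⟨0, fun _ => rfl⟩, fun _ _ => rfl⟩
  smul_mem' := by
    rintro c f ⟨⟨F, hF⟩, hf⟩
    exact ⟨⟨c • F, fun a => by simp [hF]⟩, fun a h => by simp [hf a h]⟩

/-- The Hochschild differential
`(δf)(a₁,…,aₙ₊₁) = a₁ f(a₂,…,aₙ₊₁) + ∑ᵢ (-1)ⁱ f(a₁,…,aᵢaᵢ₊₁,…,aₙ₊₁) + (-1)ⁿ⁺¹ f(a₁,…,aₙ) aₙ₊₁`. -/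
def d (n : ℕ) : ((Fin n → A) → A) →ₗ[k] ((Fin (n + 1) → A) → A) where
  toFun f a := a 0 * f (Fin.tail a)
    + ∑ i : Fin n, (-1 : k) ^ ((i : ℕ) + 1) • f (Fin.contractNth i.castSucc (· * ·) a)
    + (-1 : k) ^ (n + 1) • (f (Fin.init a) * a (Fin.last n))
  map_add' f g := by
    funext a
    simp only [Pi.add_apply, mul_add, add_mul, smul_add, Finset.sum_add_distrib]
    abel
  map_smul' c f := by
    funext a
    simp only [Pi.smul_apply, mul_smul_comm, smul_mul_assoc, smul_add, Finset.smul_sum,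
      RingHom.id_apply, smul_comm c]

/-- Normalized Hochschild cocycles. -/
def cocycle (n : ℕ) : Submodule k ((Fin n → A) → A) :=
  cochain k A n ⊓ LinearMap.ker (d k A n)

/-- Normalized Hochschild coboundaries. -/
def coboundary : (n : ℕ) → Submodule k ((Fin n → A) → A)
  | 0 => ⊥
  | n + 1 => (cochain k A n).map (d k A n)

/-- The Hochschild cohomology `HHⁿ(A) = HHⁿ(A, A)`. -/
def HH (n : ℕ) : Type v :=
  cocycle k A n ⧸ (coboundary k A n).submoduleOf (cocycle k A n)

instance (n : ℕ) : AddCommGroup (HH k A n) :=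
  inferInstanceAs (AddCommGroup (cocycle k A n ⧸ (coboundary k A n).submoduleOf (cocycle k A n)))

instance (n : ℕ) : Module k (HH k A n) :=
  inferInstanceAs (Module k (cocycle k A n ⧸ (coboundary k A n).submoduleOf (cocycle k A n)))

/-- The cohomology class of a normalized Hochschild cocycle. -/
def cls (n : ℕ) : cocycle k A n →ₗ[k] HH k A n :=
  ((coboundary k A n).submoduleOf (cocycle k A n)).mkQ

/-- The cup product of cochains,
`(f ∪ g)(a₁,…,aₙ₊ₘ) = f(a₁,…,aₙ) g(aₙ₊₁,…,aₙ₊ₘ)`. -/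
def cup (n m : ℕ) :
    ((Fin n → A) → A) →ₗ[k] ((Fin m → A) → A) →ₗ[k] ((Fin (n + m) → A) → A) :=
  LinearMap.mk₂ k
    (fun f g a => f (fun i => a (Fin.castAdd m i)) * g (fun j => a (Fin.natAdd n j)))
    (fun f f' g => by funext a; simp [add_mul])
    (fun c f g => by funext a; simp)
    (fun f g g' => by funext a; simp [mul_add])
    (fun c f g => by funext a; simp)

variable {k A}

theorem cup_apply {n m : ℕ} (f : (Fin n → A) → A) (g : (Fin m → A) → A) (a : Fin (n + m) → A) :
    cup k A n m f g a
      = f (fun i => a (Fin.castAdd m i)) * g (fun j => a (Fin.natAdd n j)) := rfl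

theorem d_apply {n : ℕ} (f : (Fin n → A) → A) (a : Fin (n + 1) → A) :
    d k A n f a = a 0 * f (Fin.tail a)
      + ∑ i : Fin n, (-1 : k) ^ ((i : ℕ) + 1) • f (Fin.contractNth i.castSucc (· * ·) a)
      + (-1 : k) ^ (n + 1) • (f (Fin.init a) * a (Fin.last n)) := rfl

theorem cup_mem_cochain {n m : ℕ} {f : (Fin n → A) → A} {g : (Fin m → A) → A}
    (hf : f ∈ cochain k A n) (hg : g ∈ cochain k A m) :
    cup k A n m f g ∈ cochain k A (n + m) := by
  obtain ⟨⟨F, hF⟩, hf⟩ := hf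
  obtain ⟨⟨F', hF'⟩, hg⟩ := hg
  have key1 : ∀ (a : Fin (n + m) → A) (i : Fin n) (t : A),
      (fun j => Function.update a (Fin.castAdd m i) t (Fin.castAdd m j))
        = Function.update (fun j => a (Fin.castAdd m j)) i t := by
    intro a i t
    funext j
    by_cases h : j = i
    · subst h; simp
    · rw [Function.update_of_ne h, Function.update_of_ne]
      simpa using h
  have key2 : ∀ (a : Fin (n + m) → A) (i : Fin n) (t : A),
      (fun j => Function.update a (Fin.castAdd m i) t (Fin.natAdd n j))
        = fun j => a (Fin.natAdd n j) := by
    intro a i t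
    funext j
    rw [Function.update_of_ne]
    intro h
    have := congrArg Fin.val h
    simp at this
    omega
  have key3 : ∀ (a : Fin (n + m) → A) (i : Fin m) (t : A),
      (fun j => Function.update a (Fin.natAdd n i) t (Fin.natAdd n j))
        = Function.update (fun j => a (Fin.natAdd n j)) i t := by
    intro a i t
    funext j
    by_cases h : j = i
    · subst h; simp
    · rw [Function.update_of_ne h, Function.update_of_ne]
      simpa using h
  have key4 : ∀ (a : Fin (n + m) → A) (i : Fin m) (t : A),
      (fun j => Function.update a (Fin.natAdd n i) t (Fin.castAdd m j))
        = fun j => a (Fin.castAdd m j) := by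
    intro a i t
    funext j
    rw [Function.update_of_ne]
    intro h
    have := congrArg Fin.val h
    simp at this
    omega
  refine ⟨⟨MultilinearMap.mk' (fun a => F (fun i => a (Fin.castAdd m i))
      * F' (fun j => a (Fin.natAdd n j))) ?_ ?_, fun a => ?_⟩, ?_⟩
  · intro a i
    refine Fin.addCases (fun i x y => ?_) (fun i x y => ?_) i
    · simp only [key1, key2, MultilinearMap.map_update_add, add_mul]
    · simp only [key3, key4, MultilinearMap.map_update_add, mul_add]
  · intro a i
    refine Fin.addCases (fun i c x => ?_) (fun i c x => ?_) i
    · simp only [key1, key2, MultilinearMap.map_update_smul, smul_mul_assoc]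
    · simp only [key3, key4, MultilinearMap.map_update_smul, mul_smul_comm]
  · simp only [MultilinearMap.mk'_apply, hF, hF', cup_apply]
  · rintro a ⟨i, hi⟩
    revert hi
    refine Fin.addCases (fun i hi => ?_) (fun i hi => ?_) i
    · rw [cup_apply, hf _ ⟨i, hi⟩, zero_mul]
    · rw [cup_apply, hg _ ⟨i, hi⟩, mul_zero]

/-- The Leibniz rule. -/
theorem d_cup {n m : ℕ} (f : (Fin n → A) → A) (g : (Fin m → A) → A) (a : Fin (n + m + 1) → A) :
    d k A (n + m) (cup k A n m f g) a
      = d k A n f (fun i => a ⟨i, by omega⟩) * g (fun j => a ⟨n + 1 + j, by omega⟩)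
        + (-1 : k) ^ n • (f (fun i => a ⟨i, by omega⟩)
          * d k A m g (fun j => a ⟨n + j, by omega⟩)) := by
  rw [d_apply, d_apply, d_apply, Fin.sum_univ_add]
  simp only [cup_apply]
  have e1 : (fun i : Fin n => Fin.tail a (Fin.castAdd m i))
      = Fin.tail (fun i : Fin (n + 1) => a ⟨i, by omega⟩) := by
    funext i
    exact congrArg a (Fin.ext (by simp))
  have e2 : (fun j : Fin m => Fin.tail a (Fin.natAdd n j))
      = fun j : Fin m => a ⟨n + 1 + j, by omega⟩ := by
    funext i
    exact congrArg a (Fin.ext (by simp; omega))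
  have e3 : (fun i : Fin n => Fin.init a (Fin.castAdd m i))
      = fun i : Fin n => a ⟨i, by omega⟩ := by
    funext i
    exact congrArg a (Fin.ext (by simp))
  have e4 : (fun j : Fin m => Fin.init a (Fin.natAdd n j))
      = Fin.init (fun j : Fin (m + 1) => a ⟨n + j, by omega⟩) := by
    funext i
    exact congrArg a (Fin.ext (by simp))
  have e5 : ∀ i : Fin n, (fun j : Fin n =>
        Fin.contractNth (Fin.castSucc (Fin.castAdd m i)) (· * ·) a (Fin.castAdd m j))
      = Fin.contractNth i.castSucc (· * ·) (fun i : Fin (n + 1) => a ⟨i, by omega⟩) := by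
    intro i
    funext j
    simp only [Fin.contractNth]
    rfl
  have e6 : ∀ i : Fin n, (fun j : Fin m =>
        Fin.contractNth (Fin.castSucc (Fin.castAdd m i)) (· * ·) a (Fin.natAdd n j))
      = fun j : Fin m => a ⟨n + 1 + j, by omega⟩ := by
    intro i
    funext j
    rw [Fin.contractNth_apply_of_gt _ _ _ _ (by simp; omega)]
    exact congrArg a (Fin.ext (by simp; omega))
  have e7 : ∀ i : Fin m, (fun j : Fin n =>
        Fin.contractNth (Fin.castSucc (Fin.natAdd n i)) (· * ·) a (Fin.castAdd m j))
      = fun j : Fin n => a ⟨j, by omega⟩ := by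
    intro i
    funext j
    rw [Fin.contractNth_apply_of_lt _ _ _ _ (by simp; omega)]
    exact congrArg a (Fin.ext (by simp))
  have e8 : ∀ i : Fin m, (fun j : Fin m =>
        Fin.contractNth (Fin.castSucc (Fin.natAdd n i)) (· * ·) a (Fin.natAdd n j))
      = Fin.contractNth i.castSucc (· * ·) (fun j : Fin (m + 1) => a ⟨n + j, by omega⟩) := by
    intro i
    funext j
    simp only [Fin.contractNth, Fin.val_natAdd, Fin.val_castSucc, add_lt_add_iff_left,
      add_right_inj]
    rfl
  have e9 : Fin.tail (fun j : Fin (m + 1) => a ⟨n + j, by omega⟩)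
      = fun j : Fin m => a ⟨n + 1 + j, by omega⟩ := by
    funext i
    exact congrArg a (Fin.ext (by simp; omega))
  have e10 : Fin.init (fun i : Fin (n + 1) => a ⟨i, by omega⟩)
      = fun i : Fin n => a ⟨i, by omega⟩ := rfl
  simp only [e1, e2, e3, e4, e5, e6, e7, e8, e9, e10]
  have e11 : a (Fin.last (n + m)) = a ⟨n + m, by omega⟩ := rfl
  simp only [add_mul, mul_add, smul_add, Finset.sum_mul, Finset.mul_sum, Finset.smul_sum,
    smul_mul_assoc, mul_smul_comm, smul_smul, mul_assoc, Fin.val_zero, Fin.val_last,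
    Fin.val_castAdd, Fin.val_natAdd, e11, add_zero, Fin.zero_eta, ← pow_add, ← add_assoc]
  have e12 : (-1 : k) ^ (n + 1) = - (-1) ^ n := by ring
  rw [e12]
  simp only [neg_smul]
  abel

theorem mem_coboundary {n N : ℕ} (h : n + 1 = N) {f : (Fin N → A) → A} {g : (Fin n → A) → A}
    (hg : g ∈ cochain k A n) (hfg : ∀ a, f a = d k A n g (fun i => a (Fin.cast h i))) :
    f ∈ coboundary k A N := by
  subst h
  exact ⟨g, hg, funext fun a => (hfg a).symm⟩

theorem cup_mem_cocycle {n m : ℕ} {f : (Fin n → A) → A} {g : (Fin m → A) → A}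
    (hf : f ∈ cocycle k A n) (hg : g ∈ cocycle k A m) :
    cup k A n m f g ∈ cocycle k A (n + m) := by
  refine ⟨cup_mem_cochain hf.1 hg.1, ?_⟩
  have hf' : d k A n f = 0 := hf.2
  have hg' : d k A m g = 0 := hg.2
  change d k A (n + m) (cup k A n m f g) = 0
  funext a
  rw [d_cup, hf', hg']
  simp

theorem cup_mem_coboundary_left {n m : ℕ} {f : (Fin n → A) → A} {g : (Fin m → A) → A}
    (hf : f ∈ coboundary k A n) (hg : g ∈ cocycle k A m) :
    cup k A n m f g ∈ coboundary k A (n + m) := by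
  cases n with
  | zero =>
    obtain rfl : f = 0 := hf
    simp
  | succ n =>
    obtain ⟨f', hf', rfl⟩ := hf
    have hg' : d k A m g = 0 := hg.2
    refine mem_coboundary (n := n + m) (by omega) (cup_mem_cochain hf' hg.1) fun a => ?_
    rw [d_cup, hg', cup_apply]
    simp only [Pi.zero_apply, mul_zero, smul_zero, add_zero]
    rfl

theorem cup_mem_coboundary_right {n m : ℕ} {f : (Fin n → A) → A} {g : (Fin m → A) → A}
    (hf : f ∈ cocycle k A n) (hg : g ∈ coboundary k A m) :
    cup k A n m f g ∈ coboundary k A (n + m) := by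
  cases m with
  | zero =>
    obtain rfl : g = 0 := hg
    simp
  | succ m =>
    obtain ⟨g', hg', rfl⟩ := hg
    have hf' : d k A n f = 0 := hf.2
    refine mem_coboundary (n := n + m) (by omega)
      ((cochain k A (n + m)).smul_mem ((-1 : k) ^ n) (cup_mem_cochain hf.1 hg')) fun a => ?_
    rw [map_smul, Pi.smul_apply, d_cup, hf', cup_apply, smul_add, smul_smul, ← pow_add,
      Even.neg_one_pow ⟨n, rfl⟩]
    simp only [Pi.zero_apply, zero_mul, smul_zero, zero_add, one_smul]
    rfl

variable (k A)

/-- The cup product of cocycles. -/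
def cupCocycle (n m : ℕ) : cocycle k A n →ₗ[k] cocycle k A m →ₗ[k] cocycle k A (n + m) :=
  LinearMap.mk₂ k (fun f g => ⟨cup k A n m f g, cup_mem_cocycle f.2 g.2⟩)
    (fun f f' g => Subtype.ext (by simp))
    (fun c f g => Subtype.ext (by simp))
    (fun f g g' => Subtype.ext (by simp))
    (fun c f g => Subtype.ext (by simp))

/-- The cup product `HHⁿ(A) × HHᵐ(A) → HHⁿ⁺ᵐ(A)`, `[f] ∪ [g] = [f ∪ g]`. -/
def cupHH (n m : ℕ) : HH k A n →ₗ[k] HH k A m →ₗ[k] HH k A (n + m) :=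
  Submodule.liftQ _
    { toFun := fun f => Submodule.mapQ _ _ (cupCocycle k A n m f)
        (fun _ hg => cup_mem_coboundary_right f.2 hg)
      map_add' := fun f f' => by
        refine Submodule.linearMap_qext _ (LinearMap.ext fun g => ?_)
        simp
        rfl
      map_smul' := fun c f => by
        refine Submodule.linearMap_qext _ (LinearMap.ext fun g => ?_)
        simp
        rfl }
    (fun f hf => by
      rw [LinearMap.mem_ker]
      refine Submodule.linearMap_qext _ (LinearMap.ext fun g => ?_)
      exact (Submodule.Quotient.mk_eq_zero
        ((coboundary k A (n + m)).submoduleOf (cocycle k A (n + m)))).2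
        (show (cupCocycle k A n m f g : (Fin (n + m) → A) → A) ∈ coboundary k A (n + m) from
          cup_mem_coboundary_left hf g.2))

theorem cupHH_cls (n m : ℕ) (f : cocycle k A n) (g : cocycle k A m) :
    cupHH k A n m (cls k A n f) (cls k A m g) = cls k A (n + m) (cupCocycle k A n m f g) := rfl

/-- The constant `0`-cocycle with value `r · 1`. -/
def scalar : k →ₗ[k] cocycle k A 0 where
  toFun r := ⟨fun _ => algebraMap k A r,
    ⟨⟨MultilinearMap.constOfIsEmpty k _ (algebraMap k A r), fun _ => rfl⟩, fun _ h => h.choose.elim0⟩,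
    by
      change d k A 0 _ = 0
      funext a
      rw [d_apply]
      simp [Algebra.commutes]⟩
  map_add' r s := Subtype.ext (funext fun _ => map_add _ r s)
  map_smul' r s := Subtype.ext (funext fun _ => by simp [Algebra.smul_def])

theorem cls_surjective (n : ℕ) : Function.Surjective (cls k A n) :=
  Submodule.mkQ_surjective _

variable {k A}

theorem cls_sigma_eq {n m : ℕ} (h : m = n) {f : cocycle k A n} {g : cocycle k A m}
    (hfg : ∀ a : Fin n → A, (f : (Fin n → A) → A) a
      = (g : (Fin m → A) → A) (fun i => a (Fin.cast h i))) :
    (GradedMonoid.mk n (cls k A n f) : GradedMonoid (HH k A))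
      = GradedMonoid.mk m (cls k A m g) := by
  subst h
  obtain rfl : f = g := Subtype.ext (funext hfg)
  rfl

theorem cup_assoc_apply {n m l : ℕ} (f : (Fin n → A) → A) (g : (Fin m → A) → A)
    (h : (Fin l → A) → A) (a : Fin (n + m + l) → A) :
    cup k A (n + m) l (cup k A n m f g) h a
      = cup k A n (m + l) f (cup k A m l g h)
          (fun i => a (Fin.cast (Nat.add_assoc n m l).symm i)) := by
  simp only [cup_apply, mul_assoc]
  congr 1
  congr 1
  refine congrArg h (funext fun i => congrArg a (Fin.ext ?_))
  simp [Nat.add_assoc]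

/-- The unit of the Hochschild cohomology ring: the class of `1 ∈ A`. -/
instance : GradedMonoid.GOne (HH k A) where
  one := cls k A 0 (scalar k A 1)

/-- The product of the Hochschild cohomology ring: the cup product. -/
instance : GradedMonoid.GMul (HH k A) where
  mul {n m} a b := cupHH k A n m a b

/-- The Hochschild cohomology ring: the cup product makes the family `HHⁿ(A)` a graded ring, with
unit the class of `1 ∈ A`; the ring itself is the direct sum `⨁ n, HHⁿ(A)`. -/
instance : DirectSum.GRing (HH k A) where
  mul_zero {n m} a := map_zero (cupHH k A n m a)
  zero_mul {n m} b := LinearMap.map_zero₂ (cupHH k A n m) b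
  mul_add {n m} a b c := map_add (cupHH k A n m a) b c
  add_mul {n m} a b c := LinearMap.map_add₂ (cupHH k A n m) a b c
  one_mul := by
    rintro ⟨n, a⟩
    obtain ⟨f, rfl⟩ := cls_surjective k A n a
    refine cls_sigma_eq (f := cupCocycle k A 0 n (scalar k A 1) f) (Nat.zero_add n).symm fun a => ?_
    change algebraMap k A 1 * _ = _
    rw [map_one, one_mul]
    refine congrArg f.1 (funext fun i => congrArg a (Fin.ext ?_))
    simp
  mul_one := by
    rintro ⟨n, a⟩
    obtain ⟨f, rfl⟩ := cls_surjective k A n a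
    refine cls_sigma_eq (f := cupCocycle k A n 0 f (scalar k A 1)) (Nat.add_zero n).symm fun a => ?_
    change _ * algebraMap k A 1 = _
    rw [map_one, mul_one]
    rfl
  mul_assoc := by
    rintro ⟨n, a⟩ ⟨m, b⟩ ⟨l, c⟩
    obtain ⟨f, rfl⟩ := cls_surjective k A n a
    obtain ⟨g, rfl⟩ := cls_surjective k A m b
    obtain ⟨h, rfl⟩ := cls_surjective k A l c
    exact cls_sigma_eq (f := cupCocycle k A (n + m) l (cupCocycle k A n m f g) h)
      (g := cupCocycle k A n (m + l) f (cupCocycle k A m l g h)) (Nat.add_assoc n m l).symm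
      fun a => cup_assoc_apply f.1 g.1 h.1 a
  natCast r := cls k A 0 (scalar k A r)
  natCast_zero := by simp
  natCast_succ r := by simp [GradedMonoid.GOne.one]
  intCast r := cls k A 0 (scalar k A r)
  intCast_ofNat r := by simp
  intCast_negSucc_ofNat r := by simp

/-- The `k`-algebra structure of the Hochschild cohomology ring. -/
instance : DirectSum.GAlgebra k (HH k A) where
  toFun := ((cls k A 0).comp (scalar k A)).toAddMonoidHom
  map_one := rfl
  map_mul r s := by
    refine cls_sigma_eq (f := scalar k A (r * s))
      (g := cupCocycle k A 0 0 (scalar k A r) (scalar k A s)) rfl fun a => ?_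
    exact map_mul (algebraMap k A) r s
  commutes := by
    rintro r ⟨n, a⟩
    obtain ⟨f, rfl⟩ := cls_surjective k A n a
    refine cls_sigma_eq (f := cupCocycle k A 0 n (scalar k A r) f)
      (g := cupCocycle k A n 0 f (scalar k A r)) (Nat.zero_add n).symm fun a => ?_
    change algebraMap k A r * _ = _ * algebraMap k A r
    rw [Algebra.commutes]
    refine congrArg (· * algebraMap k A r)
      (congrArg f.1 (funext fun i => congrArg a (Fin.ext ?_)))
    simp
  smul_def := by
    rintro r ⟨n, a⟩
    obtain ⟨f, rfl⟩ := cls_surjective k A n a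
    refine cls_sigma_eq (f := r • f)
      (g := cupCocycle k A 0 n (scalar k A r) f) (Nat.zero_add n) fun a => ?_
    change r • f.1 a = algebraMap k A r * _
    rw [Algebra.smul_def]
    refine congrArg (algebraMap k A r * ·)
      (congrArg f.1 (funext fun i => congrArg a (Fin.ext ?_)))
    simp

end Hochschild

/-! ### Cohomology of a group with trivial coefficients, through the normalized bar resolution -/

namespace GroupBar

universe u v

variable (k : Type u) [CommRing k] (H : Type v) [Group H]

/-- Normalized cochains of degree `n` of the group `H` with coefficients in the trivial module `k`:
the maps `Hⁿ → k` which vanish as soon as one argument is `1`, that is, the maps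
`(H - {1})ⁿ → k` extended by zero. -/
def cochain (n : ℕ) : Submodule k ((Fin n → H) → k) where
  carrier := {f | ∀ h : Fin n → H, (∃ i, h i = 1) → f h = 0}
  add_mem' := by
    intro f g hf hg h hh
    simp [hf h hh, hg h hh]
  zero_mem' := fun _ _ => rfl
  smul_mem' := by
    intro c f hf h hh
    simp [hf h hh]

/-- The differential
`(δf)(h₁,…,hₙ₊₁) = f(h₂,…,hₙ₊₁) + ∑ᵢ (-1)ⁱ f(h₁,…,hᵢhᵢ₊₁,…,hₙ₊₁) + (-1)ⁿ⁺¹ f(h₁,…,hₙ)`. -/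
def d (n : ℕ) : ((Fin n → H) → k) →ₗ[k] ((Fin (n + 1) → H) → k) where
  toFun f h := f (Fin.tail h)
    + ∑ i : Fin n, (-1 : k) ^ ((i : ℕ) + 1) • f (Fin.contractNth i.castSucc (· * ·) h)
    + (-1 : k) ^ (n + 1) • f (Fin.init h)
  map_add' f g := by
    funext a
    simp only [Pi.add_apply, smul_add, Finset.sum_add_distrib]
    abel
  map_smul' c f := by
    funext a
    simp only [Pi.smul_apply, smul_add, Finset.smul_sum, RingHom.id_apply, smul_comm c]

/-- Normalized cocycles. -/
def cocycle (n : ℕ) : Submodule k ((Fin n → H) → k) :=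
  cochain k H n ⊓ LinearMap.ker (d k H n)

/-- Normalized coboundaries. -/
def coboundary : (n : ℕ) → Submodule k ((Fin n → H) → k)
  | 0 => ⊥
  | n + 1 => (cochain k H n).map (d k H n)

/-- The group cohomology `Hⁿ(H, k)` with coefficients in the trivial module `k`. -/
def Coh (n : ℕ) : Type (max u v) :=
  cocycle k H n ⧸ (coboundary k H n).submoduleOf (cocycle k H n)

instance (n : ℕ) : AddCommGroup (Coh k H n) :=
  inferInstanceAs (AddCommGroup (cocycle k H n ⧸ (coboundary k H n).submoduleOf (cocycle k H n)))

instance (n : ℕ) : Module k (Coh k H n) :=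
  inferInstanceAs (Module k (cocycle k H n ⧸ (coboundary k H n).submoduleOf (cocycle k H n)))

/-- The cohomology class of a normalized cocycle. -/
def cls (n : ℕ) : cocycle k H n →ₗ[k] Coh k H n :=
  ((coboundary k H n).submoduleOf (cocycle k H n)).mkQ

end GroupBar

/-! ### The additive decomposition of the Hochschild cohomology of a group algebra -/

universe u v

/-- The choices behind the additive decomposition: a set `reps` of representatives `x` of the
conjugacy classes of `G` and, for each `x`, a set `coset x = {γ₁ = 1, γ₂, …}` of representatives
of the right cosets `C_G(x) γᵢ` of the centralizer of `x`. -/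
structure ConjRepData (G : Type v) [Group G] where
  /-- The representatives of the conjugacy classes. -/
  reps : Finset G
  existsUnique_rep : ∀ g : G, ∃! x, x ∈ reps ∧ IsConj x g
  /-- The representatives of the right cosets of the centralizer. -/
  coset : reps → Finset G
  isComplement : ∀ x : reps,
    Subgroup.IsComplement (Subgroup.centralizer {(x : G)} : Set G) (coset x : Set G)
  one_mem : ∀ x : reps, 1 ∈ coset x

namespace ConjRepData

variable {G : Type v} [Group G] (D : ConjRepData G)

/-- The centralizer `C_G(x)`. -/
abbrev C (x : D.reps) : Subgroup G := Subgroup.centralizer {(x : G)}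

/-- The conjugate `γ⁻¹ x γ` of `x` attached to a coset representative `γ` (`x_i` for `γ = γᵢ`). -/
def conj (x : D.reps) (γ : D.coset x) : G := (γ : G)⁻¹ * x * γ

/-- The element `h ∈ C_G(x)` in the decomposition `g = h γ`. -/
def head (x : D.reps) (g : G) : D.C x :=
  ⟨((D.isComplement x).equiv g).1, ((D.isComplement x).equiv g).1.2⟩

/-- The coset representative `γ` in the decomposition `g = h γ`. -/
def rep (x : D.reps) (g : G) : D.coset x :=
  ⟨((D.isComplement x).equiv g).2, ((D.isComplement x).equiv g).2.2⟩

theorem head_mul_rep (x : D.reps) (g : G) : (D.head x g : G) * (D.rep x g : G) = g :=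
  (D.isComplement x).equiv_fst_mul_equiv_snd g

/-- The sequence `(h₁, …, hₙ)` in `C_G(x)` determined by a coset representative `γ` and
`g₁, …, gₙ ∈ G` through `γ g₁ = h₁ γ'`, `γ' g₂ = h₂ γ''`, …, where `γ', γ'', …` are coset
representatives. -/
def word (x : D.reps) : {n : ℕ} → D.coset x → (Fin n → G) → (Fin n → D.C x)
  | 0, _, _ => Fin.elim0
  | _ + 1, γ, g =>
    Fin.cons (D.head x (γ * g 0)) (word x (D.rep x (γ * g 0)) (Fin.tail g))

variable (k : Type u) [Field k]

/-- The product `g₁ ⋯ gₙ`. -/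
abbrev wordProd {n : ℕ} (g : Fin n → G) : G := (List.ofFn g).prod

/-- The cochain `φ ↦ φ̂ₓ`, where `φ̂ₓ(h₁,…,hₙ)` is the coefficient of `x` in
`φ(h₁,…,hₙ) hₙ⁻¹ ⋯ h₁⁻¹`. (If `φ` is the sum over the representatives `y` of its components `φ_y`,
for which `φ_y(g₁,…,gₙ) gₙ⁻¹ ⋯ g₁⁻¹` is supported on the conjugacy class of `y`, only `φₓ`
contributes.) -/
def hat (x : D.reps) (n : ℕ) :
    ((Fin n → MonoidAlgebra k G) → MonoidAlgebra k G) →ₗ[k] ((Fin n → D.C x) → k) where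
  toFun φ h := (φ (fun i => MonoidAlgebra.of k G (h i))
    * MonoidAlgebra.of k G (wordProd fun i => (h i : G))⁻¹).coeff x
  map_add' φ ψ := by funext h; simp [add_mul]
  map_smul' c φ := by funext h; simp

theorem hat_apply (x : D.reps) (n : ℕ) (φ : (Fin n → MonoidAlgebra k G) → MonoidAlgebra k G)
    (h : Fin n → D.C x) :
    D.hat k x n φ h = (φ (fun i => MonoidAlgebra.of k G (h i))
      * MonoidAlgebra.of k G (wordProd fun i => (h i : G))⁻¹).coeff x := rfl

theorem coeff_conj (g y : G) (a : MonoidAlgebra k G) (hg : g * y = y * g) :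
    (MonoidAlgebra.of k G g * a * MonoidAlgebra.of k G g⁻¹).coeff y = a.coeff y := by
  simp only [MonoidAlgebra.of_apply]
  rw [MonoidAlgebra.coeff_mul_single_eq_coeff_mul (g * y),
    MonoidAlgebra.coeff_single_mul_eq_mul_coeff y]
  · simp
  · intro m _
    exact mul_right_inj g
  · intro m _
    rw [mul_inv_eq_iff_eq_mul, hg]

theorem wordProd_contractNth {H : Type*} [Group H] {n : ℕ} (i : Fin n) (g : Fin (n + 1) → H) :
    wordProd (Fin.contractNth i.castSucc (· * ·) g) = wordProd g := by
  have h := congrFun (Fin.partialProd_contractNth g i.castSucc) (Fin.last n)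
  have h1 : i.castSucc.succ.succAbove (Fin.last n) = Fin.last (n + 1) := by
    rw [Fin.succAbove_of_le_castSucc]
    · rfl
    · rw [Fin.le_def]; simp
  simp only [Function.comp_apply, h1, Fin.partialProd] at h
  rwa [List.take_of_length_le (by simp), List.take_of_length_le (by simp)] at h

theorem hat_d (x : D.reps) (n : ℕ) (φ : (Fin n → MonoidAlgebra k G) → MonoidAlgebra k G) :
    D.hat k x (n + 1) (Hochschild.d k (MonoidAlgebra k G) n φ)
      = GroupBar.d k (D.C x) n (D.hat k x n φ) := by
  funext h
  have hcomm : (h 0 : G) * x = x * (h 0 : G) :=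
    Subgroup.mem_centralizer_singleton_iff.1 (h 0).2
  have hP1 : wordProd (fun i => (h i : G)) = h 0 * wordProd (fun i => (Fin.tail h i : G)) := by
    simp only [wordProd, List.ofFn_succ, List.prod_cons]
    rfl
  have hP2 : wordProd (fun i => (h i : G))
      = wordProd (fun i => (Fin.init h i : G)) * h (Fin.last n) := by
    simp only [wordProd, List.ofFn_succ', List.concat_eq_append, List.prod_append,
      List.prod_singleton]
    rfl
  have hc : ∀ i : Fin n, (fun j => ((Fin.contractNth i.castSucc (· * ·) h : Fin n → D.C x) j : G))
      = Fin.contractNth i.castSucc (· * ·) (fun j => (h j : G)) := fun i =>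
    Fin.comp_contractNth (f := fun y : D.C x => (y : G)) _ _ (fun _ _ => rfl) _ _
  have hc' : ∀ i : Fin n,
      (fun j => MonoidAlgebra.of k G
        ((Fin.contractNth i.castSucc (· * ·) h : Fin n → D.C x) j))
      = Fin.contractNth i.castSucc (· * ·) (fun j => MonoidAlgebra.of k G (h j)) := fun i =>
    Fin.comp_contractNth (f := fun y : D.C x => MonoidAlgebra.of k G y) _ _
      (fun _ _ => by simp) _ _
  have h1 : (MonoidAlgebra.of k G (h 0) * φ (fun i => MonoidAlgebra.of k G (Fin.tail h i))
      * MonoidAlgebra.of k G (wordProd fun i => (h i : G))⁻¹).coeff x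
      = D.hat k x n φ (Fin.tail h) := by
    rw [hP1, mul_inv_rev, map_mul, ← mul_assoc, mul_assoc (MonoidAlgebra.of k G (h 0 : G)),
      coeff_conj k _ _ _ hcomm, hat_apply]
  have h2 : (φ (fun i => MonoidAlgebra.of k G (Fin.init h i))
      * MonoidAlgebra.of k G (h (Fin.last n))
      * MonoidAlgebra.of k G (wordProd fun i => (h i : G))⁻¹).coeff x
      = D.hat k x n φ (Fin.init h) := by
    rw [hP2, mul_assoc, ← map_mul, mul_inv_rev, mul_inv_cancel_left, hat_apply]
  have h3 : ∀ i : Fin n, (φ (Fin.contractNth i.castSucc (· * ·)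
        (fun j => MonoidAlgebra.of k G (h j)))
      * MonoidAlgebra.of k G (wordProd fun i => (h i : G))⁻¹).coeff x
      = D.hat k x n φ (Fin.contractNth i.castSucc (· * ·) h) := by
    intro i
    rw [hat_apply, hc, hc', wordProd_contractNth]
  rw [hat_apply, Hochschild.d_apply, add_mul, add_mul, Finset.sum_mul]
  simp only [smul_mul_assoc, MonoidAlgebra.coeff_add, MonoidAlgebra.coeff_sum,
    MonoidAlgebra.coeff_smul, Finsupp.add_apply, Finsupp.smul_apply, Finsupp.finsetSum_apply, h3]
  refine congrArg₂ (· + ·) (congrArg₂ (· + ·) h1 rfl) (congrArg _ h2)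

theorem hat_mem_cochain (x : D.reps) {n : ℕ}
    {φ : (Fin n → MonoidAlgebra k G) → MonoidAlgebra k G}
    (hφ : φ ∈ Hochschild.cochain k (MonoidAlgebra k G) n) :
    D.hat k x n φ ∈ GroupBar.cochain k (D.C x) n := by
  rintro h ⟨i, hi⟩
  rw [hat_apply, hφ.2 _ ⟨i, by simp [hi, MonoidAlgebra.one_def]⟩, zero_mul]
  rfl

theorem hat_mem_cocycle (x : D.reps) {n : ℕ}
    {φ : (Fin n → MonoidAlgebra k G) → MonoidAlgebra k G}
    (hφ : φ ∈ Hochschild.cocycle k (MonoidAlgebra k G) n) :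
    D.hat k x n φ ∈ GroupBar.cocycle k (D.C x) n := by
  refine ⟨D.hat_mem_cochain k x hφ.1, ?_⟩
  have h : Hochschild.d k (MonoidAlgebra k G) n φ = 0 := hφ.2
  change GroupBar.d k (D.C x) n (D.hat k x n φ) = 0
  rw [← hat_d, h, map_zero]

theorem hat_mem_coboundary (x : D.reps) {n : ℕ}
    {φ : (Fin n → MonoidAlgebra k G) → MonoidAlgebra k G}
    (hφ : φ ∈ Hochschild.coboundary k (MonoidAlgebra k G) n) :
    D.hat k x n φ ∈ GroupBar.coboundary k (D.C x) n := by
  cases n with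
  | zero =>
    obtain rfl : φ = 0 := hφ
    simp
  | succ n =>
    obtain ⟨ψ, hψ, rfl⟩ := hφ
    exact ⟨_, D.hat_mem_cochain k x hψ, (D.hat_d k x n ψ).symm⟩

/-- `φ ↦ φ̂ₓ` on cocycles. -/
def hatCocycle (x : D.reps) (n : ℕ) :
    Hochschild.cocycle k (MonoidAlgebra k G) n →ₗ[k] GroupBar.cocycle k (D.C x) n :=
  (D.hat k x n).restrict fun _ hφ => D.hat_mem_cocycle k x hφ

/-- The map `HHⁿ(kG) → Hⁿ(C_G(x), k)`, `[φ] ↦ [φ̂ₓ]`. -/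
def hatHH (x : D.reps) (n : ℕ) :
    Hochschild.HH k (MonoidAlgebra k G) n →ₗ[k] GroupBar.Coh k (D.C x) n :=
  Submodule.mapQ _ _ (D.hatCocycle k x n) fun _ hφ => D.hat_mem_coboundary k x hφ

variable [DecidableEq G]

/-- The degree `n` part `⨁ₓ Hⁿ(C_G(x), k)` of the sum of the cohomologies of the centralizers. -/
abbrev CentCoh (n : ℕ) : Type (max u v) := ⨁ x : D.reps, GroupBar.Coh k (D.C x) n

/-- The map `HH*(kG) → ⨁ₓ H*(C_G(x), k)`, `[φ] ↦ ∑ₓ [φ̂ₓ]`. -/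
def realization : (⨁ n, Hochschild.HH k (MonoidAlgebra k G) n) →ₗ[k] ⨁ n, D.CentCoh k n :=
  DirectSum.lmap fun n =>
    (DirectSum.linearEquivFunOnFintype k D.reps
        fun x => GroupBar.Coh k (D.C x) n).symm.toLinearMap
      ∘ₗ LinearMap.pi fun x => D.hatHH k x n

variable {k}

/-- The value at `(g₁,…,gₙ)` of the Hochschild cochain attached to `f : C_G(x)ⁿ → k`:
`∑_γ f(h₁,…,hₙ) (γ⁻¹ x γ) g₁ ⋯ gₙ`, over the coset representatives `γ`, where `(h₁,…,hₙ)` is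
the sequence determined by `γ` and `(g₁,…,gₙ)`. -/
def lift (x : D.reps) {n : ℕ} (f : (Fin n → D.C x) → k) (g : Fin n → G) : MonoidAlgebra k G :=
  ∑ γ : D.coset x, f (D.word x γ g) • MonoidAlgebra.of k G (D.conj x γ * wordProd g)

/-- The cochain `(f ∪ g)_z : C_G(z)ⁿ⁺ᵐ → k`,
`(h₁,…,hₙ₊ₘ) ↦ ∑ f(h_{i,1},…,h_{i,n}) g(h_{j,1},…,h_{j,m})`, over the pairs of coset
representatives `(γᵢ, γⱼ)` of `x` and `y` with `xᵢ (h₁⋯hₙ) yⱼ (h₁⋯hₙ)⁻¹ = z`, where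
`(h_{i,1},…,h_{i,n})` is determined by `γᵢ` and `(h₁,…,hₙ)`, and `(h_{j,1},…,h_{j,m})` by `γⱼ` and
`(hₙ₊₁,…,hₙ₊ₘ)`. -/
def cupAt (x y z : D.reps) {n m : ℕ} (f : (Fin n → D.C x) → k) (g : (Fin m → D.C y) → k) :
    (Fin (n + m) → D.C z) → k := fun h =>
  let h₁ : Fin n → G := fun i => h (Fin.castAdd m i)
  let h₂ : Fin m → G := fun j => h (Fin.natAdd n j)
  ∑ p : D.coset x × D.coset y with
      D.conj x p.1 * wordProd h₁ * D.conj y p.2 * (wordProd h₁)⁻¹ = z,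
    f (D.word x p.1 h₁) * g (D.word y p.2 h₂)

end ConjRepData

end

/-! For a Hochschild cochain `φ` and `x ∈ G`, let `Fₓ(v₀,…,vₙ)` be the coefficient of `v₀⁻¹ x vₙ` in
`φ(v₀⁻¹v₁,…,vₙ₋₁⁻¹vₙ)`; this is `hom`. In these homogeneous coordinates the Hochschild differential
is the alternating sum of the faces (`hom_d`), `Fₓ` is invariant under left translation by `C_G(x)`
(`hom_smul`), and normalization means vanishing on tuples with two equal neighbours. A multilinear
`φ` is determined by the `Fₓ` for `x ∈ X` (`eq_of_hom_eq`), and these can be prescribed one at a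
time (`exists_cochain_hom_eq`). So the Hochschild complex splits as a sum over `x` of complexes of
normalized `C_G(x)`-invariant cochains on `G`, and `φ̂ₓ` is the restriction of `Fₓ` to tuples in
`C_G(x)` (`hat_eq_hom`).

The map `r : G → C_G(x)`, `hγ ↦ h` (`head`), is `C_G(x)`-equivariant, and it is a retraction because
`1` is a coset representative. Pullback along `r` (`homExtend`) is therefore a section of
restriction; by `word_eq` it is the formula `lift`. This gives surjectivity on cohomology
(`exists_cocycle_lift`). Restriction followed by pullback is composition with `r`, which the prism
operator makes homotopic to the identity (`d_prism_add_prism_d`). The prism preserves normalization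
and invariance, whence injectivity (`mem_coboundary_of_hat`).

The product on the right-hand side is the cup product transported along this isomorphism, so it
inherits the algebra axioms. Its explicit formula holds already for cochains: multiply two lifts and
read off the coefficient of `z` (`hat_cup`). -/

/-! ### Homogeneous and inhomogeneous coordinates -/

/-- The sequence `v₀⁻¹v₁, v₁⁻¹v₂, …` of successive quotients. -/
def succQuot {H : Type*} [Group H] {n : ℕ} (v : Fin (n + 1) → H) : Fin n → H :=
  fun i => (v i.castSucc)⁻¹ * v i.succ

section SuccQuot

variable {H : Type*} [Group H]

theorem smul_partialProd_succQuot {n : ℕ} (v : Fin (n + 1) → H) :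
    v 0 • Fin.partialProd (succQuot v) = v :=
  Fin.partialProd_left_inv v

theorem succQuot_smul {n : ℕ} (u : H) (v : Fin (n + 1) → H) : succQuot (u • v) = succQuot v := by
  funext i
  simp [succQuot, mul_assoc]

theorem succQuot_partialProd {n : ℕ} (g : Fin n → H) : succQuot (Fin.partialProd g) = g :=
  funext fun i => Fin.partialProd_right_inv g i

theorem succQuot_removeNth_zero {n : ℕ} (v : Fin (n + 2) → H) :
    succQuot (Fin.removeNth 0 v) = Fin.tail (succQuot v) := by
  funext i
  simp [succQuot, Fin.removeNth, Fin.tail]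

theorem succQuot_removeNth_last {n : ℕ} (v : Fin (n + 2) → H) :
    succQuot (Fin.removeNth (Fin.last (n + 1)) v) = Fin.init (succQuot v) := by
  funext i
  simp [succQuot, Fin.removeNth, Fin.init]

/-- Deleting an interior vertex `b` between `a` and `c` merges two quotients, as `(a⁻¹b)(b⁻¹c) =
a⁻¹c`. This is why the inner faces become the contractions of the bar differential. -/
theorem succQuot_removeNth_succ_castSucc {n : ℕ} (v : Fin (n + 2) → H) (i : Fin n) :
    succQuot (Fin.removeNth i.castSucc.succ v)
      = Fin.contractNth i.castSucc (· * ·) (succQuot v) := by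
  have h : Fin.removeNth i.castSucc.succ v
      = v 0 • Fin.partialProd (Fin.contractNth i.castSucc (· * ·) (succQuot v)) := by
    conv_lhs => rw [← smul_partialProd_succQuot v]
    rw [Fin.partialProd_contractNth]
    rfl
  rw [h, succQuot_smul, succQuot_partialProd]

theorem partialProd_last {n : ℕ} (g : Fin n → H) :
    Fin.partialProd g (Fin.last n) = (List.ofFn g).prod := by
  rw [Fin.partialProd, List.take_of_length_le (by simp)]

theorem prod_ofFn_succQuot {n : ℕ} (v : Fin (n + 1) → H) :
    (List.ofFn (succQuot v)).prod = (v 0)⁻¹ * v (Fin.last n) := by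
  conv_rhs => rw [← smul_partialProd_succQuot v]
  simp [partialProd_last]

end SuccQuot

/-! ### Cochains in homogeneous coordinates -/

namespace HomogeneousBar

variable {k : Type*} [CommRing k] {G : Type*}

/-- The alternating sum of the faces. -/
def d (n : ℕ) (F : (Fin n → G) → k) (v : Fin (n + 1) → G) : k :=
  ∑ i : Fin (n + 1), (-1 : k) ^ (i : ℕ) * F (Fin.removeNth i v)

/-- The prism operator
`v ↦ ∑ᵢ (-1)ⁱ F(r v₀, …, r vᵢ, vᵢ, …, vₙ)` of a map `r : G → G`. -/
def prism (r : G → G) : (n : ℕ) → ((Fin (n + 1) → G) → k) → (Fin n → G) → k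
  | 0, _, _ => 0
  | n + 1, F, v => F (Fin.cons (r (v 0)) v)
      - prism r n (fun w => F (Fin.cons (r (v 0)) w)) (Fin.tail v)

/-- Splitting off the zeroth face gives `d` the same recursive shape as `prism`, so the homotopy
identity follows by induction without any double sum. -/
theorem d_succ (n : ℕ) (F : (Fin (n + 1) → G) → k) (v : Fin (n + 2) → G) :
    d (n + 1) F v = F (Fin.tail v) - d n (fun w => F (Fin.cons (v 0) w)) (Fin.tail v) := by
  rw [d, Fin.sum_univ_succ, d, sub_eq_add_neg, ← Finset.sum_neg_distrib]
  congr 1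
  · simp [Fin.removeNth_zero]
  · refine Finset.sum_congr rfl fun i _ => ?_
    have h : Fin.removeNth i.succ v = Fin.cons (v 0) (Fin.removeNth i (Fin.tail v)) := by
      funext j
      refine Fin.cases ?_ (fun j => ?_) j
      · simp [Fin.removeNth]
      · simp [Fin.removeNth, Fin.tail]
    rw [h, Fin.val_succ, pow_succ]
    ring

theorem d_add (n : ℕ) (F F' : (Fin n → G) → k) : d n (F + F') = d n F + d n F' := by
  funext v
  simp [d, mul_add, Finset.sum_add_distrib]

theorem d_sub (n : ℕ) (F F' : (Fin n → G) → k) : d n (F - F') = d n F - d n F' := by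
  funext v
  simp [d, mul_sub, Finset.sum_sub_distrib]

theorem prism_sub (r : G → G) (n : ℕ) (F F' : (Fin (n + 1) → G) → k) (v : Fin n → G) :
    prism r n (fun w => F w - F' w) v = prism r n F v - prism r n F' v := by
  induction n with
  | zero => simp [prism]
  | succ n ih => simp only [prism, ih]; ring

theorem prism_zero (r : G → G) (n : ℕ) (v : Fin n → G) :
    prism r n (fun _ => (0 : k)) v = 0 := by
  induction n with
  | zero => rfl
  | succ n ih => simp [prism, ih]

/-- The prism operator is a homotopy between the identity and the pullback along `r`. -/
theorem d_prism_add_prism_d (r : G → G) (n : ℕ) (F : (Fin (n + 1) → G) → k)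
    (v : Fin (n + 1) → G) :
    d n (prism r n F) v + prism r (n + 1) (d (n + 1) F) v = F v - F (fun i => r (v i)) := by
  induction n with
  | zero =>
    have h : Fin.removeNth 1 (Fin.cons (r (v 0)) v : Fin 2 → G) = fun i => r (v i) := by
      funext i
      obtain rfl : i = 0 := Fin.fin_one_eq_zero i
      rfl
    simp [prism, d, Fin.removeNth_zero, h, sub_eq_add_neg]
  | succ n ih =>
    have h : Fin.cons (r (v 0)) (fun i => r (Fin.tail v i)) = fun i => r (v i) := by
      funext i
      refine Fin.cases rfl (fun i => rfl) i
    -- The induction runs on the cochain with first argument frozen at `r v₀`; the terms `F(r v₀,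
    -- v₀, …)` from the two composites cancel.
    have h1 := ih (fun w => F (Fin.cons (r (v 0)) w)) (Fin.tail v)
    rw [h] at h1
    have h2 : d n (fun w => prism r (n + 1) F (Fin.cons (v 0) w)) (Fin.tail v)
        = d n (fun w => F (Fin.cons (r (v 0)) (Fin.cons (v 0) w))) (Fin.tail v)
          - d n (prism r n fun w => F (Fin.cons (r (v 0)) w)) (Fin.tail v) := by
      rw [← Pi.sub_apply, ← d_sub]
      rfl
    have h3 : prism r (n + 2) (d (n + 2) F) v
        = F v - d (n + 1) (fun w => F (Fin.cons (r (v 0)) w)) v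
          - (prism r (n + 1) F (Fin.tail v)
            - prism r (n + 1) (d (n + 1) fun w => F (Fin.cons (r (v 0)) w)) (Fin.tail v)) := by
      rw [prism, ← prism_sub, d_succ]
      simp only [Fin.tail_cons, Fin.cons_zero, d_succ (n + 1) F]
    rw [d_succ, h2, h3, d_succ]
    linear_combination h1

/-- A cochain is normalized if it vanishes on the sequences with two equal consecutive entries. -/
def IsNormalized {n : ℕ} (F : (Fin (n + 1) → G) → k) : Prop :=
  ∀ v : Fin (n + 1) → G, (∃ i : Fin n, v i.castSucc = v i.succ) → F v = 0

theorem IsNormalized.add {n : ℕ} {F F' : (Fin (n + 1) → G) → k} (hF : IsNormalized F)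
    (hF' : IsNormalized F') : IsNormalized (F + F') := fun v hv => by
  rw [Pi.add_apply, hF v hv, hF' v hv, add_zero]

theorem IsNormalized.cons {n : ℕ} {F : (Fin (n + 2) → G) → k} (hF : IsNormalized F) (u : G) :
    IsNormalized (fun w : Fin (n + 1) → G => F (Fin.cons u w)) := by
  rintro v ⟨i, hi⟩
  refine hF _ ⟨i.succ, ?_⟩
  rw [← Fin.succ_castSucc, Fin.cons_succ, Fin.cons_succ, hi]

/-- A repetition in `v` survives in the leading term `F(r v₀, v₀, …)`. If it is not at the start, it
also lies in the tail and induction applies. If `v₀ = v₁`, all other terms begin with `r v₀, r v₁`,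
which are equal. -/
theorem IsNormalized.prism {r : G → G} {n : ℕ} {F : (Fin (n + 2) → G) → k}
    (hF : IsNormalized F) : IsNormalized (prism r (n + 1) F) := by
  induction n with
  | zero => rintro v ⟨i, _⟩; exact i.elim0
  | succ n ih =>
    rintro v ⟨i, hi⟩
    rw [HomogeneousBar.prism, hF _ ⟨i.succ, ?_⟩, zero_sub, neg_eq_zero]
    · revert hi
      refine Fin.cases (fun hi => ?_) (fun i hi => ?_) i
      · have h1 : v 0 = Fin.tail v 0 := hi
        rw [HomogeneousBar.prism, ← h1, hF _ ⟨0, rfl⟩, zero_sub, neg_eq_zero]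
        have h2 : (fun w : Fin (n + 1) → G =>
            F (Fin.cons (r (v 0)) (Fin.cons (r (v 0)) w))) = fun _ => 0 :=
          funext fun w => hF _ ⟨0, rfl⟩
        rw [h2, prism_zero]
      · exact ih (hF.cons _) _ ⟨i, hi⟩
    · rw [← Fin.succ_castSucc, Fin.cons_succ, Fin.cons_succ, hi]

/-- Two cochains are needed for the induction: freezing the first argument produces `F(r v₀, ·)` on
one side and `F'(c r v₀, ·)` on the other, different functions even when `F = F'`. -/
theorem prism_smul [Group G] {r : G → G} {c : G} (hr : ∀ u, r (c * u) = c * r u) {n : ℕ}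
    {F F' : (Fin (n + 1) → G) → k} (hF : ∀ v, F' (c • v) = F v) (v : Fin n → G) :
    prism r n F' (c • v) = prism r n F v := by
  have hcons : ∀ {m : ℕ} (u : G) (w : Fin m → G),
      (Fin.cons (c * u) (c • w) : Fin (m + 1) → G) = c • (Fin.cons u w : Fin (m + 1) → G) := by
    intro m u w
    funext i
    exact Fin.cases rfl (fun _ => rfl) i
  induction n with
  | zero => rfl
  | succ n ih =>
    simp only [prism]
    have h0 : r ((c • v) 0) = c * r (v 0) := hr _
    rw [h0, hcons, hF]
    congr 1
    exact ih (fun w => by rw [hcons, hF]) (Fin.tail v)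

/-- In homogeneous coordinates, the differential of the bar complex is the alternating sum of the
faces. -/
theorem d_comp_succQuot {H : Type*} [Group H] {n : ℕ} (f : (Fin n → H) → k)
    (v : Fin (n + 2) → H) :
    d (n + 1) (fun w => f (succQuot w)) v = GroupBar.d k H n f (succQuot v) := by
  rw [d, Fin.sum_univ_succ, Fin.sum_univ_castSucc]
  simp only [succQuot_removeNth_zero, Fin.succ_last, succQuot_removeNth_last,
    succQuot_removeNth_succ_castSucc]
  simp [GroupBar.d, add_assoc]

end HomogeneousBar

/-! ### Multilinearity of the Hochschild differential -/

namespace Hochschild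

variable {k : Type*} [CommRing k] {A : Type*} [Ring A] [Algebra k A]

/-- The changed argument either passes through untouched (possibly shifted by one place) or is a
factor of the merged entry. Accordingly `L` is the identity, or multiplication by the other factor
on the right (`j = i`) or left (`j = i + 1`). -/
theorem exists_contractNth_update {n : ℕ} (i : Fin n) (a : Fin (n + 1) → A) (j : Fin (n + 1)) :
    ∃ (p : Fin n) (L : A →ₗ[k] A), ∀ t, Fin.contractNth i.castSucc (· * ·) (Function.update a j t)
      = Function.update (Fin.contractNth i.castSucc (· * ·) a) p (L t) := by
  rcases lt_trichotomy (j : ℕ) i with h | h | h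
  · refine ⟨⟨j, by omega⟩, LinearMap.id, fun t => funext fun q => ?_⟩
    simp only [Fin.contractNth, Function.update_apply, Fin.ext_iff, Fin.val_castSucc,
      Fin.val_succ, LinearMap.id_apply]
    grind
  · refine ⟨i, LinearMap.mulRight k (a i.succ), fun t => funext fun q => ?_⟩
    simp only [Fin.contractNth, Function.update_apply, Fin.ext_iff, Fin.val_castSucc,
      Fin.val_succ, LinearMap.mulRight_apply]
    grind
  · rcases eq_or_ne (j : ℕ) (i + 1) with h' | h'
    · refine ⟨i, LinearMap.mulLeft k (a i.castSucc), fun t => funext fun q => ?_⟩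
      simp only [Fin.contractNth, Function.update_apply, Fin.ext_iff, Fin.val_castSucc,
        Fin.val_succ, LinearMap.mulLeft_apply]
      grind
    · refine ⟨⟨j - 1, by omega⟩, LinearMap.id, fun t => funext fun q => ?_⟩
      simp only [Fin.contractNth, Function.update_apply, Fin.ext_iff, Fin.val_castSucc,
        Fin.val_succ, LinearMap.id_apply]
      grind

/-- The differential of a multilinear cochain is multilinear. -/
theorem exists_multilinearMap_d {n : ℕ} (F : MultilinearMap k (fun _ : Fin n => A) A) :
    ∃ F' : MultilinearMap k (fun _ : Fin (n + 1) => A) A, ∀ a, F' a = d k A n F a := by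
  let L : MultilinearMap k (fun _ : Fin (n + 1) => A) A :=
    LinearMap.uncurryLeft
      { toFun := fun x => (LinearMap.mulLeft k x).compMultilinearMap F
        map_add' := fun x y => by ext; simp [add_mul]
        map_smul' := fun c x => by ext; simp }
  let R : MultilinearMap k (fun _ : Fin (n + 1) => A) A :=
    MultilinearMap.uncurryRight ((LinearMap.mul k A).compMultilinearMap F)
  let M (i : Fin n) : MultilinearMap k (fun _ : Fin (n + 1) => A) A :=
    MultilinearMap.mk' (fun a => F (Fin.contractNth i.castSucc (· * ·) a))
      (fun a j x y => by
        obtain ⟨p, L, h⟩ := exists_contractNth_update (k := k) i a j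
        simp only [h, map_add, MultilinearMap.map_update_add])
      (fun a j c x => by
        obtain ⟨p, L, h⟩ := exists_contractNth_update (k := k) i a j
        simp only [h, map_smul, MultilinearMap.map_update_smul])
  refine ⟨L + ∑ i : Fin n, (-1 : k) ^ ((i : ℕ) + 1) • M i + (-1 : k) ^ (n + 1) • R, fun a => ?_⟩
  simp [d_apply, L, R, M]

end Hochschild

/-! ### Coefficients and multilinear extension over the group algebra -/

namespace MonoidAlgebra

variable {k : Type*} [CommRing k] {G : Type*} [Group G]

theorem coeff_of_mul (g y : G) (a : MonoidAlgebra k G) :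
    (of k G g * a).coeff y = a.coeff (g⁻¹ * y) := by
  rw [of_apply, coeff_single_mul_eq_mul_coeff (g⁻¹ * y), one_mul]
  intro m _
  rw [eq_inv_mul_iff_mul_eq]

theorem coeff_mul_of (g y : G) (a : MonoidAlgebra k G) :
    (a * of k G g).coeff y = a.coeff (y * g⁻¹) := by
  rw [of_apply, coeff_mul_single_eq_coeff_mul (y * g⁻¹), mul_one]
  intro m _
  rw [eq_mul_inv_iff_mul_eq]

/-- A function on `Gⁿ` which vanishes as soon as one argument is `1` extends to a normalized
Hochschild cochain. -/
theorem exists_cochain [Finite G] {n : ℕ} (w : (Fin n → G) → MonoidAlgebra k G)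
    (hw : ∀ g, (∃ i, g i = 1) → w g = 0) :
    ∃ φ ∈ Hochschild.cochain k (MonoidAlgebra k G) n,
      ∀ g : Fin n → G, φ (fun i => of k G (g i)) = w g := by
  classical
  cases nonempty_fintype G
  let c (g : G) : MonoidAlgebra k G →ₗ[k] k :=
    { toFun := fun a => a.coeff g
      map_add' := fun a b => by simp
      map_smul' := fun r a => by simp }
  -- Expansion in the basis `Gⁿ`; finiteness of `G` makes the sum finite.
  let F : MultilinearMap k (fun _ : Fin n => MonoidAlgebra k G) (MonoidAlgebra k G) :=
    ∑ g : Fin n → G, ((MultilinearMap.mkPiAlgebra k (Fin n) k).compLinearMap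
      fun i => c (g i)).smulRight (w g)
  have hF : ∀ a, F a = ∑ g : Fin n → G, (∏ i, (a i).coeff (g i)) • w g := fun a => by
    simp [F]
    rfl
  refine ⟨F, ⟨⟨F, fun _ => rfl⟩, ?_⟩, fun g => ?_⟩
  · rintro a ⟨i, hi⟩
    rw [hF]
    refine Finset.sum_eq_zero fun g _ => ?_
    by_cases h : g i = 1
    · rw [hw g ⟨i, h⟩, smul_zero]
    · rw [Finset.prod_eq_zero (Finset.mem_univ i), zero_smul]
      rw [hi, one_def, coeff_single, Finsupp.single_apply, if_neg (Ne.symm h)]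
  · rw [hF, Finset.sum_eq_single g]
    · simp
    · intro g' _ hg'
      obtain ⟨i, hi⟩ := Function.ne_iff.1 hg'
      rw [Finset.prod_eq_zero (Finset.mem_univ i), zero_smul]
      rw [of_apply, coeff_single, Finsupp.single_apply, if_neg (Ne.symm hi)]
    · simp

end MonoidAlgebra

/-! ### Hochschild cochains of a group algebra in homogeneous coordinates -/

namespace ConjRepData

universe u v

/-! ### The decomposition `g = h γ` and conjugates of the representatives -/

section Head

variable {G : Type v} [Group G] (D : ConjRepData G)

theorem head_mul (x : D.reps) (c : D.C x) (u : G) : D.head x (c * u) = c * D.head x u := by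
  have h := (D.isComplement x).equiv_mul_left c u
  exact Subtype.ext (congrArg (fun p => (p.1 : G)) h)

theorem head_coe (x : D.reps) (c : D.C x) : D.head x c = c :=
  Subtype.ext (congrArg Subtype.val
    ((D.isComplement x).equiv_fst_eq_self_of_mem_of_one_mem (D.one_mem x) c.2))

theorem head_coset (x : D.reps) (γ : D.coset x) : D.head x γ = 1 :=
  Subtype.ext (congrArg Subtype.val
    ((D.isComplement x).equiv_fst_eq_one_of_mem_of_one_mem (Subgroup.one_mem _) γ.2))

theorem rep_coset (x : D.reps) (γ : D.coset x) : D.rep x γ = γ :=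
  Subtype.ext (congrArg Subtype.val
    ((D.isComplement x).equiv_snd_eq_self_of_mem_of_one_mem (Subgroup.one_mem _) γ.2))

theorem rep_mul (x : D.reps) (c : D.C x) (u : G) : D.rep x (c * u) = D.rep x u := by
  have h := (D.isComplement x).equiv_mul_left c u
  exact Subtype.ext (congrArg (fun p => (p.2 : G)) h)

/-- The recursion gives `γ g₁⋯gᵢ = h₁⋯hᵢ γ'` with `γ'` a coset representative. So the heads are the
partial products of the word, and their successive quotients are its letters. -/
theorem word_eq (x : D.reps) {n : ℕ} (γ : D.coset x) (g : Fin n → G) :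
    D.word x γ g = succQuot fun i => D.head x (γ * Fin.partialProd g i) := by
  induction n generalizing γ with
  | zero => exact Subsingleton.elim _ _
  | succ n ih =>
    have h : ∀ i : Fin (n + 1), D.head x (γ * Fin.partialProd g i.succ)
        = D.head x (γ * g 0)
          * D.head x (D.rep x (γ * g 0) * Fin.partialProd (Fin.tail g) i) := by
      intro i
      rw [← head_mul, ← mul_assoc, head_mul_rep, Fin.partialProd_succ', mul_assoc]
    funext i
    rw [word, ih]
    refine Fin.cases ?_ (fun i => ?_) i
    · have h0 := h 0
      rw [Fin.partialProd_zero, mul_one, head_coset _ _ (D.rep x _), mul_one] at h0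
      rw [Fin.cons_zero, succQuot, h0, Fin.castSucc_zero, Fin.partialProd_zero, mul_one,
        head_coset, inv_one, one_mul]
    · rw [Fin.cons_succ, succQuot, succQuot, h, ← Fin.succ_castSucc, h]
      group

theorem conj_eq_conj_iff (x y : D.reps) (u v : G) :
    u⁻¹ * x * u = v⁻¹ * y * v ↔ x = y ∧ u * v⁻¹ ∈ D.C x := by
  constructor
  · intro h
    have hxy : x = y := by
      have hc : IsConj (y : G) x := by
        refine isConj_iff.2 ⟨u * v⁻¹, ?_⟩
        have h2 : u * (v⁻¹ * y * v) * u⁻¹ = x := by rw [← h]; group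
        rw [← h2]; group
      exact Subtype.ext
        ((D.existsUnique_rep x).unique ⟨x.2, IsConj.refl _⟩ ⟨y.2, hc⟩)
    subst hxy
    refine ⟨rfl, Subgroup.mem_centralizer_singleton_iff.2 ?_⟩
    calc u * v⁻¹ * (x : G) = u * (v⁻¹ * x * v) * v⁻¹ := by group
      _ = x * (u * v⁻¹) := by rw [← h]; group
  · rintro ⟨rfl, h⟩
    have h' := Subgroup.mem_centralizer_singleton_iff.1 h
    calc u⁻¹ * (x : G) * u = u⁻¹ * (x * (u * v⁻¹)) * v := by group
      _ = v⁻¹ * x * v := by rw [← h']; group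

end Head

section Hom

variable {G : Type v} [Group G] {k : Type u} [CommRing k]

/-- The component at `x ∈ G` of a Hochschild cochain, in homogeneous coordinates. -/
noncomputable def hom (x : G) (n : ℕ) :
    ((Fin n → MonoidAlgebra k G) → MonoidAlgebra k G) →ₗ[k] ((Fin (n + 1) → G) → k) where
  toFun φ v := (φ (fun i => MonoidAlgebra.of k G (succQuot v i))).coeff
    ((v 0)⁻¹ * x * v (Fin.last n))
  map_add' φ ψ := by funext v; simp
  map_smul' c φ := by funext v; simp

theorem hom_apply (x : G) {n : ℕ} (φ : (Fin n → MonoidAlgebra k G) → MonoidAlgebra k G)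
    (v : Fin (n + 1) → G) :
    hom x n φ v = (φ (fun i => MonoidAlgebra.of k G (succQuot v i))).coeff
      ((v 0)⁻¹ * x * v (Fin.last n)) := rfl

/-- Multiplying by the first argument `v₀⁻¹v₁` on the left, or by the last one on the right, shifts
the coefficient read off. The shift replaces the end point `v₀`, respectively `vₙ₊₁`, by its
neighbour, as an outer face does; inner faces leave the end points alone. -/
theorem hom_d (x : G) (n : ℕ) (φ : (Fin n → MonoidAlgebra k G) → MonoidAlgebra k G) :
    hom x (n + 1) (Hochschild.d k (MonoidAlgebra k G) n φ)
      = HomogeneousBar.d (n + 1) (hom x n φ) := by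
  funext v
  have hc : ∀ i : Fin n, (fun j => MonoidAlgebra.of k G
        (Fin.contractNth i.castSucc (· * ·) (succQuot v) j))
      = Fin.contractNth i.castSucc (· * ·) (fun j => MonoidAlgebra.of k G (succQuot v j)) := fun i =>
    Fin.comp_contractNth (f := fun y : G => MonoidAlgebra.of k G y) _ _
      (fun _ _ => by simp) _ _
  have h0 : hom x n φ (Fin.removeNth 0 v)
      = (MonoidAlgebra.of k G (succQuot v 0)
          * φ (Fin.tail fun i => MonoidAlgebra.of k G (succQuot v i))).coeff
        ((v 0)⁻¹ * x * v (Fin.last (n + 1))) := by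
    rw [MonoidAlgebra.coeff_of_mul, hom_apply, succQuot_removeNth_zero]
    simp [Fin.removeNth, succQuot, Fin.tail_def, mul_assoc]
  have hlast : hom x n φ (Fin.removeNth (Fin.last (n + 1)) v)
      = (φ (Fin.init fun i => MonoidAlgebra.of k G (succQuot v i))
          * MonoidAlgebra.of k G (succQuot v (Fin.last n))).coeff
        ((v 0)⁻¹ * x * v (Fin.last (n + 1))) := by
    rw [MonoidAlgebra.coeff_mul_of, hom_apply, succQuot_removeNth_last]
    simp [Fin.removeNth, succQuot, Fin.init_def, mul_assoc]
  have hmid : ∀ i : Fin n, hom x n φ (Fin.removeNth i.castSucc.succ v)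
      = (φ (Fin.contractNth i.castSucc (· * ·)
          fun j => MonoidAlgebra.of k G (succQuot v j))).coeff
        ((v 0)⁻¹ * x * v (Fin.last (n + 1))) := by
    intro i
    rw [hom_apply, succQuot_removeNth_succ_castSucc, hc]
    have e : i.castSucc.succ.succAbove (Fin.last n) = Fin.last (n + 1) := by
      rw [Fin.succAbove_of_le_castSucc]
      · rfl
      · rw [Fin.le_def]; simp
    have e' : i.castSucc.succ.succAbove 0 = 0 := by
      cases n with
      | zero => exact i.elim0
      | succ n => exact Fin.succ_succAbove_zero _
    rw [Fin.removeNth, Fin.removeNth, e, e']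
  rw [HomogeneousBar.d, Fin.sum_univ_succ, Fin.sum_univ_castSucc, Fin.succ_last, h0, hlast,
    hom_apply, Hochschild.d_apply]
  simp only [hmid, MonoidAlgebra.coeff_add, MonoidAlgebra.coeff_sum, MonoidAlgebra.coeff_smul,
    Finsupp.add_apply, Finsupp.smul_apply, Finsupp.finsetSum_apply, smul_eq_mul]
  simp [add_assoc]

theorem hom_isNormalized (x : G) {n : ℕ} {φ : (Fin n → MonoidAlgebra k G) → MonoidAlgebra k G}
    (hφ : φ ∈ Hochschild.cochain k (MonoidAlgebra k G) n) :
    HomogeneousBar.IsNormalized (hom x n φ) := by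
  rintro v ⟨i, hi⟩
  rw [hom_apply, hφ.2 _ ⟨i, by simp [succQuot, hi, MonoidAlgebra.one_def]⟩]
  rfl

variable (D : ConjRepData G)

theorem hom_smul (x : D.reps) {n : ℕ} (φ : (Fin n → MonoidAlgebra k G) → MonoidAlgebra k G)
    (c : D.C x) (v : Fin (n + 1) → G) : hom (x : G) n φ ((c : G) • v) = hom (x : G) n φ v := by
  have hc : (c : G) * x = x * c := Subgroup.mem_centralizer_singleton_iff.1 c.2
  rw [hom_apply, hom_apply, succQuot_smul]
  congr 1
  simp only [Pi.smul_apply, smul_eq_mul, mul_inv_rev]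
  calc (v 0)⁻¹ * (c : G)⁻¹ * x * (c * v (Fin.last n))
      = (v 0)⁻¹ * (c : G)⁻¹ * (x * c) * v (Fin.last n) := by group
    _ = _ := by rw [← hc]; group

/-- A multilinear cochain is determined by its components at the conjugacy class representatives. -/
theorem eq_of_hom_eq {n : ℕ} (F F' : MultilinearMap k (fun _ : Fin n => MonoidAlgebra k G)
    (MonoidAlgebra k G)) (h : ∀ x : D.reps, hom (x : G) n F = hom (x : G) n F') : F = F' := by
  refine Module.Basis.ext_multilinear (fun _ => MonoidAlgebra.basis G k) fun g => ?_
  refine MonoidAlgebra.ext (Finsupp.ext fun a => ?_)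
  -- If `c x c⁻¹ = a (g₁⋯gₙ)⁻¹`, the tuple `c⁻¹, c⁻¹g₁, …, c⁻¹g₁⋯gₙ` has quotients `g` and reads off
  -- the coefficient of `c x c⁻¹ g₁⋯gₙ = a`.
  obtain ⟨x, ⟨hx, hxc⟩, -⟩ := D.existsUnique_rep (a * (List.ofFn g).prod⁻¹)
  obtain ⟨c, hc⟩ := isConj_iff.1 hxc
  have h1 := congrFun (h ⟨x, hx⟩) (c⁻¹ • Fin.partialProd g)
  rw [hom_apply, hom_apply, succQuot_smul, succQuot_partialProd] at h1
  have h2 : ((c⁻¹ • Fin.partialProd g) 0)⁻¹ * x * (c⁻¹ • Fin.partialProd g) (Fin.last n) = a := by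
    simp only [Pi.smul_apply, smul_eq_mul, Fin.partialProd_zero, partialProd_last, mul_one, inv_inv]
    rw [← mul_assoc, hc, inv_mul_cancel_right]
  simpa only [h2, MonoidAlgebra.basis_apply, MonoidAlgebra.of_apply] using h1

/-- The components see values on group elements only; multilinearity of the differential is what
extends the vanishing to all arguments. -/
theorem mem_cocycle_of_hom {n : ℕ} {φ : (Fin n → MonoidAlgebra k G) → MonoidAlgebra k G}
    (hφ : φ ∈ Hochschild.cochain k (MonoidAlgebra k G) n)
    (h : ∀ x : D.reps, HomogeneousBar.d (n + 1) (hom (x : G) n φ) = 0) :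
    φ ∈ Hochschild.cocycle k (MonoidAlgebra k G) n := by
  refine ⟨hφ, ?_⟩
  obtain ⟨⟨F, hF⟩, -⟩ := hφ
  obtain rfl : ⇑F = φ := funext hF
  obtain ⟨F', hF'⟩ := Hochschild.exists_multilinearMap_d F
  have h0 : F' = 0 := D.eq_of_hom_eq _ _ fun x => by
    rw [show (F' : _ → _) = Hochschild.d k _ n F from funext hF', hom_d, h]
    exact (map_zero (hom (x : G) (n + 1))).symm
  exact funext fun a => by rw [← hF', h0]; rfl

theorem d_eq_of_hom {n : ℕ} {φ : (Fin n → MonoidAlgebra k G) → MonoidAlgebra k G}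
    {ψ : (Fin (n + 1) → MonoidAlgebra k G) → MonoidAlgebra k G}
    (hφ : φ ∈ Hochschild.cochain k (MonoidAlgebra k G) n)
    (hψ : ψ ∈ Hochschild.cochain k (MonoidAlgebra k G) (n + 1))
    (h : ∀ x : D.reps, HomogeneousBar.d (n + 1) (hom (x : G) n φ) = hom (x : G) (n + 1) ψ) :
    Hochschild.d k (MonoidAlgebra k G) n φ = ψ := by
  obtain ⟨⟨F, hF⟩, -⟩ := hφ
  obtain rfl : ⇑F = φ := funext hF
  obtain ⟨⟨P, hP⟩, -⟩ := hψ
  obtain rfl : ⇑P = ψ := funext hP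
  obtain ⟨F', hF'⟩ := Hochschild.exists_multilinearMap_d F
  have h0 : F' = P := D.eq_of_hom_eq _ _ fun x => by
    rw [show (F' : _ → _) = Hochschild.d k _ n F from funext hF', hom_d, h]
  exact funext fun a => by rw [← hF', h0]

/-- A normalized `C_G(x)`-invariant homogeneous cochain is the component at `x` of a normalized
Hochschild cochain with no other component. -/
theorem exists_cochain_hom_eq [Finite G] (x : D.reps) {n : ℕ} {F : (Fin (n + 1) → G) → k}
    (hF : HomogeneousBar.IsNormalized F) (hinv : ∀ (c : D.C x) v, F ((c : G) • v) = F v) :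
    ∃ φ ∈ Hochschild.cochain k (MonoidAlgebra k G) n,
      (∀ g : Fin n → G, φ (fun i => MonoidAlgebra.of k G (g i))
        = ∑ γ : D.coset x, F ((γ : G) • Fin.partialProd g)
            • MonoidAlgebra.of k G (D.conj x γ * wordProd g)) ∧
      hom (x : G) n φ = F ∧ ∀ y : D.reps, y ≠ x → hom (y : G) n φ = 0 := by
  classical
  obtain ⟨φ, hφ, h⟩ := MonoidAlgebra.exists_cochain
    (fun g : Fin n → G => ∑ γ : D.coset x, F ((γ : G) • Fin.partialProd g)
      • MonoidAlgebra.of k G (D.conj x γ * wordProd g)) (by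
    rintro g ⟨i, hi⟩
    refine Finset.sum_eq_zero fun γ _ => ?_
    rw [hF _ ⟨i, ?_⟩, zero_smul]
    simp [Fin.partialProd_succ, hi])
  -- The `γ`-term contributes exactly when `γ⁻¹xγ = v₀⁻¹yv₀`. This forces `y = x` and leaves a
  -- single `γ`, the representative of the coset of `v₀`.
  have key : ∀ (y : D.reps) (v : Fin (n + 1) → G), hom (y : G) n φ v
      = ∑ γ : D.coset x, if x = y ∧ (γ : G) * (v 0)⁻¹ ∈ D.C x then
          F ((γ : G) • Fin.partialProd (succQuot v)) else 0 := by
    intro y v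
    rw [hom_apply, h, MonoidAlgebra.coeff_sum, Finsupp.finsetSum_apply]
    refine Finset.sum_congr rfl fun γ _ => ?_
    rw [MonoidAlgebra.coeff_smul, Finsupp.smul_apply, MonoidAlgebra.of_apply,
      MonoidAlgebra.coeff_single, Finsupp.single_apply, smul_ite, smul_zero, smul_eq_mul, mul_one]
    refine if_congr ?_ rfl rfl
    rw [← D.conj_eq_conj_iff, wordProd, prod_ofFn_succQuot, conj, ← mul_assoc,
      mul_left_inj, ← eq_mul_inv_iff_mul_eq, inv_inv]
  refine ⟨φ, hφ, h, funext fun v => ?_, fun y hy => funext fun v => ?_⟩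
  · have hh := D.head_mul_rep x (v 0)
    have e : (D.rep x (v 0) : G) = ((D.head x (v 0))⁻¹ : D.C x) * v 0 := by
      rw [Subgroup.coe_inv, eq_inv_mul_iff_mul_eq, hh]
    rw [key, Finset.sum_eq_single (D.rep x (v 0)), if_pos]
    · rw [e, ← smul_smul, hinv, smul_partialProd_succQuot]
    · refine ⟨rfl, ?_⟩
      rw [e, mul_inv_cancel_right]
      exact Subtype.property _
    · rintro γ - hγ
      refine if_neg fun hc => hγ ?_
      have := D.rep_mul x ⟨_, hc.2⟩ (v 0)
      rw [inv_mul_cancel_right, rep_coset] at this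
      exact this
    · simp
  · rw [key]
    exact Finset.sum_eq_zero fun γ _ => if_neg fun hc => hy hc.1.symm

/-- The invariant homogeneous cochain `v ↦ f(r(v₀)⁻¹ r(v₁), …)` attached to `f : C_G(x)ⁿ → k`,
where `r(v) ∈ C_G(x)` is the head of `v`. -/
noncomputable def homExtend (x : D.reps) {n : ℕ} (f : (Fin n → D.C x) → k) (v : Fin (n + 1) → G) : k :=
  f (succQuot fun i => D.head x (v i))

omit [CommRing k] in
theorem homExtend_smul (x : D.reps) {n : ℕ} (f : (Fin n → D.C x) → k) (c : D.C x)
    (v : Fin (n + 1) → G) : D.homExtend x f ((c : G) • v) = D.homExtend x f v := by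
  have h : (fun i => D.head x (((c : G) • v) i)) = c • fun i => D.head x (v i) :=
    funext fun i => D.head_mul x c (v i)
  rw [homExtend, h, succQuot_smul]
  rfl

theorem homExtend_isNormalized (x : D.reps) {n : ℕ} {f : (Fin n → D.C x) → k}
    (hf : f ∈ GroupBar.cochain k (D.C x) n) : HomogeneousBar.IsNormalized (D.homExtend x f) := by
  rintro v ⟨i, hi⟩
  exact hf _ ⟨i, by simp [succQuot, hi]⟩

theorem d_homExtend (x : D.reps) {n : ℕ} (f : (Fin n → D.C x) → k) :
    HomogeneousBar.d (n + 1) (D.homExtend x f) = D.homExtend x (GroupBar.d k (D.C x) n f) :=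
  funext fun v => HomogeneousBar.d_comp_succQuot f fun i => D.head x (v i)

end Hom

end ConjRepData

/-! ### Transport of graded algebra structures -/

namespace DirectSum

variable {k : Type*} [CommRing k] {A B : ℕ → Type*} [∀ n, AddCommGroup (A n)]
  [∀ n, AddCommGroup (B n)] [∀ n, Module k (A n)] [∀ n, Module k (B n)]
  (E : ∀ n, A n ≃ₗ[k] B n)

/-- The map induced on homogeneous elements by a family of maps. -/
def gradedMap (a : GradedMonoid A) : GradedMonoid B := ⟨a.1, E a.1 a.2⟩

theorem gradedMap_surjective : Function.Surjective (gradedMap E) := fun b =>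
  ⟨⟨b.1, (E b.1).symm b.2⟩, Sigma.ext rfl (heq_of_eq ((E b.1).apply_symm_apply b.2))⟩

variable [GRing A]

/-- The graded multiplication transported along a family of linear equivalences. -/
abbrev transportGMul : GradedMonoid.GMul B where
  mul {i j} a b := E (i + j) (GradedMonoid.GMul.mul ((E i).symm a) ((E j).symm b))

/-- The graded unit transported along a family of linear equivalences. -/
abbrev transportGOne : GradedMonoid.GOne B where
  one := E 0 GradedMonoid.GOne.one

/-- Bundling elements with their degrees lets the unit and associativity laws, whose two sides have
different types, be transported as plain equalities. -/
theorem gradedMap_mul (a b : GradedMonoid A) :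
    letI := transportGMul E
    gradedMap E (a * b) = gradedMap E a * gradedMap E b := by
  let := transportGMul E
  refine Sigma.ext rfl (heq_of_eq ?_)
  change E _ (GradedMonoid.GMul.mul a.2 b.2)
    = E _ (GradedMonoid.GMul.mul ((E a.1).symm (E a.1 a.2)) ((E b.1).symm (E b.1 b.2)))
  rw [LinearEquiv.symm_apply_apply, LinearEquiv.symm_apply_apply]

/-- The graded ring structure transported along a family of linear equivalences. -/
abbrev transportGRing : GRing B where
  __ := transportGMul E
  __ := transportGOne E
  mul_zero a := by simp [GradedMonoid.GMul.mul, GNonUnitalNonAssocSemiring.mul_zero]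
  zero_mul b := by simp [GradedMonoid.GMul.mul, GNonUnitalNonAssocSemiring.zero_mul]
  mul_add a b c := by simp [GradedMonoid.GMul.mul, GNonUnitalNonAssocSemiring.mul_add]
  add_mul a b c := by simp [GradedMonoid.GMul.mul, GNonUnitalNonAssocSemiring.add_mul]
  one_mul b := by
    let := transportGMul E
    let := transportGOne E
    obtain ⟨a, rfl⟩ := gradedMap_surjective E b
    change gradedMap E 1 * gradedMap E a = _
    rw [← gradedMap_mul, _root_.one_mul]
  mul_one b := by
    let := transportGMul E
    let := transportGOne E
    obtain ⟨a, rfl⟩ := gradedMap_surjective E b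
    change gradedMap E a * gradedMap E 1 = _
    rw [← gradedMap_mul, _root_.mul_one]
  mul_assoc a b c := by
    let := transportGMul E
    obtain ⟨a, rfl⟩ := gradedMap_surjective E a
    obtain ⟨b, rfl⟩ := gradedMap_surjective E b
    obtain ⟨c, rfl⟩ := gradedMap_surjective E c
    change gradedMap E a * gradedMap E b * gradedMap E c
      = gradedMap E a * (gradedMap E b * gradedMap E c)
    simp only [← gradedMap_mul, _root_.mul_assoc]
  natCast n := E 0 (GSemiring.natCast n)
  natCast_zero := by rw [GSemiring.natCast_zero, map_zero]
  natCast_succ n := by rw [GSemiring.natCast_succ, map_add]; rfl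
  intCast n := E 0 (GRing.intCast n)
  intCast_ofNat n := by rw [GRing.intCast_ofNat]
  intCast_negSucc_ofNat n := by rw [GRing.intCast_negSucc_ofNat, map_neg]

/-- The graded algebra structure transported along a family of linear equivalences. -/
abbrev transportGAlgebra [GAlgebra k A] :
    letI := transportGRing E
    GAlgebra k B :=
  letI := transportGRing E
  { toFun := (E 0).toLinearMap.toAddMonoidHom.comp GAlgebra.toFun
    map_one := congrArg (E 0) GAlgebra.map_one
    map_mul := fun r s => by
      have h := congrArg (gradedMap E) (GAlgebra.map_mul (A := A) r s)
      exact h.trans (gradedMap_mul E (.mk _ (GAlgebra.toFun r)) (.mk _ (GAlgebra.toFun s)))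
    commutes := fun r b => by
      obtain ⟨a, rfl⟩ := gradedMap_surjective E b
      change gradedMap E (.mk _ (GAlgebra.toFun r)) * gradedMap E a
        = gradedMap E a * gradedMap E (.mk _ (GAlgebra.toFun r))
      rw [← gradedMap_mul, ← gradedMap_mul, GAlgebra.commutes]
    smul_def := fun r b => by
      obtain ⟨a, rfl⟩ := gradedMap_surjective E b
      have h : r • gradedMap E a = gradedMap E (r • a) :=
        Sigma.ext rfl (heq_of_eq (map_smul (E a.1) r a.2).symm)
      change _ = gradedMap E (.mk _ (GAlgebra.toFun r)) * gradedMap E a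
      rw [h, ← gradedMap_mul, GAlgebra.smul_def] }

/-- A family of linear equivalences is an isomorphism of algebras for the transported structure. -/
def transportAlgEquiv [GAlgebra k A] :
    letI := transportGRing E
    letI := transportGAlgebra E
    (⨁ n, A n) ≃ₐ[k] ⨁ n, B n :=
  letI := transportGRing E
  letI := transportGAlgebra E
  AlgEquiv.ofLinearEquiv (congrLinearEquiv E)
    (by
      change congrLinearEquiv E (of A 0 GradedMonoid.GOne.one) = of B 0 GradedMonoid.GOne.one
      rw [coe_congrLinearEquiv, lmap_of]
      rfl)
    (fun a b => by
      rw [coe_congrLinearEquiv]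
      induction a using DirectSum.induction_on with
      | zero => simp
      | add a a' ha ha' => rw [add_mul, map_add, ha, ha', map_add, add_mul]
      | of i a =>
        induction b using DirectSum.induction_on with
        | zero => simp
        | add b b' hb hb' => rw [mul_add, map_add, hb, hb', map_add, mul_add]
        | of j b =>
          rw [of_mul_of, lmap_of, lmap_of, lmap_of, of_mul_of]
          simp [GradedMonoid.GMul.mul])

end DirectSum

/-! ### Comparison with the cohomology of the centralizers -/

namespace ConjRepData

universe u v

variable {G : Type v} [Group G] {k : Type u} [Field k] (D : ConjRepData G)

theorem hat_eq_hom (x : D.reps) {n : ℕ} (φ : (Fin n → MonoidAlgebra k G) → MonoidAlgebra k G)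
    (h : Fin n → D.C x) :
    D.hat k x n φ h = hom (x : G) n φ (fun i => ((Fin.partialProd h i : D.C x) : G)) := by
  have h1 : succQuot (fun i => ((Fin.partialProd h i : D.C x) : G)) = fun i => (h i : G) :=
    funext fun i => congrArg Subtype.val (Fin.partialProd_right_inv h i)
  have h2 : (List.ofFn fun i => (h i : G)).prod = ((Fin.partialProd h (Fin.last n) : D.C x) : G) := by
    rw [← h1, prod_ofFn_succQuot]
    simp
  rw [hat_apply, hom_apply, h1, MonoidAlgebra.coeff_mul_of, wordProd, h2]
  simp

/-- By invariance the tuple of heads can be translated to start at `1`, where `hat_eq_hom` applies.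
-/
theorem hom_head (x : D.reps) {n : ℕ} (φ : (Fin n → MonoidAlgebra k G) → MonoidAlgebra k G)
    (v : Fin (n + 1) → G) :
    hom (x : G) n φ (fun i => D.head x (v i)) = D.homExtend x (D.hat k x n φ) v := by
  have h := smul_partialProd_succQuot fun i => D.head x (v i)
  have h' : (fun i => (D.head x (v i) : G)) = (D.head x (v 0) : G)
      • fun i => ((Fin.partialProd (succQuot fun i => D.head x (v i)) i : D.C x) : G) :=
    funext fun i => congrArg Subtype.val (congrFun h i).symm
  rw [h', hom_smul, homExtend, hat_eq_hom]

/-- Restriction undoes pullback because `head` is the identity on `C_G(x)`. -/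
theorem hat_eq_of_hom_eq_homExtend (x : D.reps) {n : ℕ}
    {φ : (Fin n → MonoidAlgebra k G) → MonoidAlgebra k G} {f : (Fin n → D.C x) → k}
    (h : hom (x : G) n φ = D.homExtend x f) : D.hat k x n φ = f := by
  funext c
  simp only [hat_eq_hom, h, homExtend, head_coe]
  exact congrArg f (succQuot_partialProd c)

/-- Every normalized cocycle of `C_G(x)` lifts to a normalized Hochschild cocycle, given by the
formula `lift`. -/
theorem exists_cocycle_lift [Finite G] (x : D.reps) {n : ℕ} (f : GroupBar.cocycle k (D.C x) n) :
    ∃ φ : Hochschild.cocycle k (MonoidAlgebra k G) n,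
      (∀ g : Fin n → G, φ.1 (fun i => MonoidAlgebra.of k G (g i)) = D.lift x f.1 g) ∧
      D.hat k x n φ.1 = f.1 ∧ ∀ y : D.reps, y ≠ x → D.hat k y n φ.1 = 0 := by
  obtain ⟨φ, hφ, h, hx, hy⟩ := D.exists_cochain_hom_eq x (D.homExtend_isNormalized x f.2.1)
    (D.homExtend_smul x f.1)
  refine ⟨⟨φ, D.mem_cocycle_of_hom hφ fun y => ?_⟩, fun g => ?_,
    D.hat_eq_of_hom_eq_homExtend x hx, fun y hyx => ?_⟩
  · rcases eq_or_ne y x with rfl | hyx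
    · have hf : GroupBar.d k (D.C y) n f.1 = 0 :=
        LinearMap.mem_ker.1 f.2.2
      rw [hx, d_homExtend, hf]
      rfl
    · rw [hy y hyx]
      funext v
      simp [HomogeneousBar.d]
  · refine (h g).trans (Finset.sum_congr rfl fun γ _ => ?_)
    rw [word_eq]
    rfl
  · funext c
    rw [hat_eq_hom, hy y hyx]
    rfl

/-- A normalized Hochschild cocycle all of whose components `φ̂ₓ` are coboundaries is a
coboundary. -/
theorem mem_coboundary_of_hat [Finite G] {n : ℕ}
    {φ : (Fin n → MonoidAlgebra k G) → MonoidAlgebra k G}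
    (hφ : φ ∈ Hochschild.cocycle k (MonoidAlgebra k G) n)
    (h : ∀ x : D.reps, D.hat k x n φ ∈ GroupBar.coboundary k (D.C x) n) :
    φ ∈ Hochschild.coboundary k (MonoidAlgebra k G) n := by
  have hd : ∀ x : D.reps, HomogeneousBar.d (n + 1) (hom (x : G) n φ) = 0 := fun x => by
    have h0 : Hochschild.d k (MonoidAlgebra k G) n φ = 0 := hφ.2
    rw [← hom_d, h0, map_zero]
  -- The prism homotopy applied to a cocycle: the term containing its differential drops out.
  have hhom : ∀ x : D.reps, hom (x : G) n φ = D.homExtend x (D.hat k x n φ)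
      + HomogeneousBar.d n (HomogeneousBar.prism (fun u => (D.head x u : G)) n (hom (x : G) n φ)) :=
    fun x => funext fun v => by
      have h1 := HomogeneousBar.d_prism_add_prism_d (fun u => (D.head x u : G)) n
        (hom (x : G) n φ) v
      rw [hd, hom_head] at h1
      have h2 := HomogeneousBar.prism_zero (k := k) (fun u => (D.head x u : G)) (n + 1) v
      rw [Pi.add_apply]
      linear_combination h2 - h1
  cases n with
  | zero =>
    -- In degree `0` the prism is zero and the only coboundary is `0`, so `φ` itself must vanish.
    obtain ⟨⟨F, hF⟩, -⟩ := hφ.1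
    obtain rfl : ⇑F = φ := funext hF
    have h0 : F = 0 := D.eq_of_hom_eq _ _ fun x => by
      have h1 : D.hat k x 0 F = 0 := h x
      rw [hhom, h1]
      funext v
      simp [homExtend, HomogeneousBar.d, HomogeneousBar.prism, hom_apply]
    rw [h0]
    rfl
  | succ n =>
    choose f hf hfd using h
    -- The primitive at `x` is the pullback of a primitive `f x` of `φ̂ₓ` plus the prism term of
    -- `hhom`. Having no component elsewhere, these primitives can be summed over `x`.
    have hex : ∀ x : D.reps, ∃ ψ ∈ Hochschild.cochain k (MonoidAlgebra k G) n,
        hom (x : G) n ψ = D.homExtend x (f x)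
          + HomogeneousBar.prism (fun u => (D.head x u : G)) (n + 1) (hom (x : G) (n + 1) φ) ∧
        ∀ y : D.reps, y ≠ x → hom (y : G) n ψ = 0 := fun x => by
      obtain ⟨ψ, hψ, -, hx, hy⟩ := D.exists_cochain_hom_eq x
        ((D.homExtend_isNormalized x (hf x)).add
          (HomogeneousBar.IsNormalized.prism (r := fun u => (D.head x u : G))
            (hom_isNormalized (x : G) hφ.1)))
        (fun c v => by
          rw [Pi.add_apply, Pi.add_apply, homExtend_smul]
          congr 1
          exact HomogeneousBar.prism_smul (fun u => by rw [head_mul]; rfl) (D.hom_smul x φ c) v)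
      exact ⟨ψ, hψ, hx, hy⟩
    choose ψ hψ hx hy using hex
    have hsum : ∀ y : D.reps, hom (y : G) n (∑ x, ψ x) = hom (y : G) n (ψ y) := fun y => by
      rw [map_sum]
      exact Finset.sum_eq_single y (fun x _ hxy => hy x y hxy.symm) (by simp)
    have hmem := Submodule.sum_mem _ fun x (_ : x ∈ Finset.univ) => hψ x
    refine ⟨∑ x, ψ x, hmem, D.d_eq_of_hom hmem hφ.1 fun y => ?_⟩
    rw [hsum, hx, HomogeneousBar.d_add, d_homExtend, hfd, ← hhom]

/-- With `w₁`, `w₂` the products of the two blocks of arguments, the `(γ, γ')` term of the product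
is a multiple of `x_γ w₁ y_γ' w₂`. Multiplying by `(w₁w₂)⁻¹` gives `x_γ w₁ y_γ' w₁⁻¹`, so the
coefficient of `z` selects exactly the pairs summed in `cupAt`. -/
theorem hat_cup (x y z : D.reps) {n m : ℕ}
    {φ : (Fin n → MonoidAlgebra k G) → MonoidAlgebra k G}
    {ψ : (Fin m → MonoidAlgebra k G) → MonoidAlgebra k G}
    {f : (Fin n → D.C x) → k} {g : (Fin m → D.C y) → k} [DecidableEq G]
    (hφ : ∀ g : Fin n → G, φ (fun i => MonoidAlgebra.of k G (g i)) = D.lift x f g)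
    (hψ : ∀ h : Fin m → G, ψ (fun i => MonoidAlgebra.of k G (h i)) = D.lift y g h) :
    D.hat k z (n + m) (Hochschild.cup k (MonoidAlgebra k G) n m φ ψ) = D.cupAt x y z f g := by
  funext h
  have hp : wordProd (fun i => (h i : G)) = wordProd (fun i => (h (Fin.castAdd m i) : G))
      * wordProd (fun j => (h (Fin.natAdd n j) : G)) := by
    rw [wordProd, List.ofFn_add, List.prod_append]
    rfl
  rw [hat_apply, Hochschild.cup_apply, hφ (fun i => (h (Fin.castAdd m i) : G)),
    hψ (fun j => (h (Fin.natAdd n j) : G)), lift, lift, Finset.sum_mul_sum,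
    ← Fintype.sum_prod_type', Finset.sum_mul, MonoidAlgebra.coeff_sum, Finsupp.finsetSum_apply,
    cupAt, Finset.sum_filter]
  refine Finset.sum_congr rfl fun p _ => ?_
  rw [smul_mul_smul_comm, smul_mul_assoc, ← map_mul, ← map_mul, MonoidAlgebra.coeff_smul,
    Finsupp.smul_apply, MonoidAlgebra.of_apply, MonoidAlgebra.coeff_single, Finsupp.single_apply,
    smul_ite, smul_zero, smul_eq_mul, mul_one]
  refine if_congr (Eq.congr_left ?_) rfl rfl
  rw [hp]
  group

theorem hatHH_cls (x : D.reps) {n : ℕ} (φ : Hochschild.cocycle k (MonoidAlgebra k G) n) :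
    D.hatHH k x n (Hochschild.cls k _ n φ) = GroupBar.cls k (D.C x) n (D.hatCocycle k x n φ) := rfl

variable (k) in
/-- The degree `n` part of `realization`. -/
noncomputable def realizationDegree (n : ℕ) :
    Hochschild.HH k (MonoidAlgebra k G) n →ₗ[k] D.CentCoh k n :=
  (DirectSum.linearEquivFunOnFintype k D.reps
    fun x => GroupBar.Coh k (D.C x) n).symm.toLinearMap ∘ₗ LinearMap.pi fun x => D.hatHH k x n

theorem realizationDegree_apply {n : ℕ} (a : Hochschild.HH k (MonoidAlgebra k G) n) (x : D.reps) :
    D.realizationDegree k n a x = D.hatHH k x n a := rfl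

theorem realizationDegree_injective [Finite G] (n : ℕ) :
    Function.Injective (D.realizationDegree k n) := by
  rw [injective_iff_map_eq_zero]
  intro a ha
  obtain ⟨φ, rfl⟩ := Hochschild.cls_surjective k _ n a
  refine (Submodule.Quotient.mk_eq_zero _).2 (D.mem_coboundary_of_hat φ.2 fun x => ?_)
  have h := DFunLike.congr_fun ha x
  rw [realizationDegree_apply, hatHH_cls] at h
  exact (Submodule.Quotient.mk_eq_zero ((GroupBar.coboundary k (D.C x) n).submoduleOf
    (GroupBar.cocycle k (D.C x) n)) (x := D.hatCocycle k x n φ)).1 h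

variable [DecidableEq G]

theorem realizationDegree_cls_eq_of (x : D.reps) {n : ℕ}
    {φ : Hochschild.cocycle k (MonoidAlgebra k G) n} {f : GroupBar.cocycle k (D.C x) n}
    (hx : D.hat k x n φ.1 = f.1) (hy : ∀ y : D.reps, y ≠ x → D.hat k y n φ.1 = 0) :
    D.realizationDegree k n (Hochschild.cls k _ n φ)
      = DirectSum.of (fun x : D.reps => GroupBar.Coh k (D.C x) n) x
          (GroupBar.cls k (D.C x) n f) := by
  refine DFinsupp.ext fun y => ?_
  change D.realizationDegree k n (Hochschild.cls k _ n φ) y = _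
  rw [realizationDegree_apply, hatHH_cls]
  rcases eq_or_ne y x with rfl | h
  · rw [DirectSum.of_eq_same]
    exact congrArg _ (Subtype.ext hx)
  · rw [DirectSum.of_eq_of_ne _ _ _ h]
    have h0 : D.hatCocycle k y n φ = 0 := Subtype.ext (hy y h)
    rw [h0, map_zero]

theorem realizationDegree_surjective [Finite G] (n : ℕ) :
    Function.Surjective (D.realizationDegree k n) := by
  rw [← LinearMap.range_eq_top, eq_top_iff]
  rintro b -
  induction b using DirectSum.induction_on with
  | zero => exact Submodule.zero_mem _
  | add b b' hb hb' => exact Submodule.add_mem _ hb hb'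
  | of x b =>
    obtain ⟨f, rfl⟩ := Submodule.mkQ_surjective _ b
    obtain ⟨φ, -, hx, hy⟩ := D.exists_cocycle_lift x f
    exact ⟨_, D.realizationDegree_cls_eq_of x hx hy⟩

variable (k) in
/-- The isomorphism `HHⁿ(kG) ≃ ⨁ₓ Hⁿ(C_G(x), k)`. -/
noncomputable def realizationEquiv [Finite G] (n : ℕ) :
    Hochschild.HH k (MonoidAlgebra k G) n ≃ₗ[k] D.CentCoh k n :=
  LinearEquiv.ofBijective (D.realizationDegree k n)
    ⟨D.realizationDegree_injective n, D.realizationDegree_surjective n⟩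

end ConjRepData

theorem mainTheorem3 {k : Type*} [Field k] {G : Type*} [Group G] [Finite G] [DecidableEq G] (D : ConjRepData G) :
    ∃ (_ : DirectSum.GRing (D.CentCoh k)) (_ : DirectSum.GAlgebra k (D.CentCoh k)),
      (∀ (n m : ℕ) (x y : D.reps) (f : GroupBar.cocycle k (D.C x) n)
          (g : GroupBar.cocycle k (D.C y) m) (z : D.reps),
        ∃ h : D.cupAt x y z f.1 g.1 ∈ GroupBar.cocycle k (D.C z) (n + m),
          (GradedMonoid.GMul.mul
            (DirectSum.of (fun x : D.reps => GroupBar.Coh k (D.C x) n) x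
              (GroupBar.cls k (D.C x) n f))
            (DirectSum.of (fun y : D.reps => GroupBar.Coh k (D.C y) m) y
              (GroupBar.cls k (D.C y) m g)) : D.CentCoh k (n + m)) z
            = GroupBar.cls k (D.C z) (n + m) ⟨_, h⟩) ∧
      ∃ e : (⨁ n, Hochschild.HH k (MonoidAlgebra k G) n) ≃ₐ[k] ⨁ n, D.CentCoh k n,
        (∀ a, e a = D.realization k a) ∧
        ∀ (n : ℕ) (x : D.reps) (f : GroupBar.cocycle k (D.C x) n),
          ∃ φ : Hochschild.cocycle k (MonoidAlgebra k G) n,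
            (∀ g : Fin n → G, φ.1 (fun i => MonoidAlgebra.of k G (g i)) = D.lift x f.1 g) ∧
            e.symm (DirectSum.of (D.CentCoh k) n
              (DirectSum.of (fun x : D.reps => GroupBar.Coh k (D.C x) n) x
                (GroupBar.cls k (D.C x) n f)))
              = DirectSum.of (Hochschild.HH k (MonoidAlgebra k G)) n
                  (Hochschild.cls k (MonoidAlgebra k G) n φ) := by
  have he : ∀ {n : ℕ} {x : D.reps} {f : GroupBar.cocycle k (D.C x) n}
      {φ : Hochschild.cocycle k (MonoidAlgebra k G) n}, D.hat k x n φ.1 = f.1 →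
      (∀ y : D.reps, y ≠ x → D.hat k y n φ.1 = 0) →
      D.realizationEquiv k n (Hochschild.cls k _ n φ)
        = DirectSum.of (fun x : D.reps => GroupBar.Coh k (D.C x) n) x
            (GroupBar.cls k (D.C x) n f) := fun hx hy => D.realizationDegree_cls_eq_of _ hx hy
  let hR := DirectSum.transportGRing (D.realizationEquiv k)
  let hA := DirectSum.transportGAlgebra (D.realizationEquiv k)
  refine ⟨hR, hA, ?_,
    DirectSum.transportAlgEquiv (D.realizationEquiv k), fun _ => rfl, ?_⟩
  · intro n m x y f g z
    obtain ⟨φ, hφ, hφx, hφy⟩ := D.exists_cocycle_lift x f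
    obtain ⟨ψ, hψ, hψx, hψy⟩ := D.exists_cocycle_lift y g
    have hcup := D.hat_cup x y z hφ hψ
    refine ⟨hcup ▸ D.hat_mem_cocycle k z (Hochschild.cup_mem_cocycle φ.2 ψ.2), ?_⟩
    -- Each class is the image of its lift, so the transported product is the image of the cup
    -- product of the lifts.
    rw [← he hφx hφy, ← he hψx hψy]
    change D.realizationEquiv k (n + m) (GradedMonoid.GMul.mul
      ((D.realizationEquiv k n).symm (D.realizationEquiv k n _))
      ((D.realizationEquiv k m).symm (D.realizationEquiv k m _))) z = _
    rw [LinearEquiv.symm_apply_apply, LinearEquiv.symm_apply_apply]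
    change GroupBar.cls k (D.C z) (n + m)
      (D.hatCocycle k z (n + m) (Hochschild.cupCocycle k _ n m φ ψ)) = _
    exact congrArg _ (Subtype.ext hcup)
  · intro n x f
    obtain ⟨φ, hφ, hx, hy⟩ := D.exists_cocycle_lift x f
    refine ⟨φ, hφ, ?_⟩
    rw [AlgEquiv.symm_apply_eq, ← he hx hy]
    exact (DirectSum.lmap_of (fun n => (D.realizationEquiv k n).toLinearMap) n _).symm
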